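/- Let $d\ge 2$, $\alpha,r>0$ and $K,T\in\{1,2,\dots\}$. Write $\alpha=m+s$ with $m=\lceil\alpha-1\rceil$ and $s\in(0,1]$, and let $\mathcal H^{\alpha,r}$ be the set of $g\in C^m([0,1]^{d-1})$ with $$\max_{|\mathbf m|\le m}\|\partial^{\mathbf m}g\|_\infty+\max_{|\mathbf m|=m}\ \sup_{x\ne y}\frac{|\partial^{\mathbf m}g(x)-\partial^{\mathbf m}g(y)|}{|x-y|^{s}}\le r ,$$ where $|x-y|$ is the Euclidean distance. For $x\in\mathbb R^d$ and $j\in\{1,\dots,d\}$ let $x_{-j}\in\mathbb R^{d-1}$ be $x$ without its $j$-th coordinate. Let $\mathcal C^{\alpha,r,K,T}$ be the set of classifiers $C:[0,1]^d\to\{-1,1\}$ of the form $$C(x)=2\sum_{t=1}^T\mathbf 1(x\in A_t)-1,\qquad A_t=\bigcap_{k=1}^K\{x\in[0,1]^d:\ x_{j_{(t,k)}}\ge g_{(t,k)}(x_{-j_{(t,k)}})\},$$ with $g_{(t,k)}\in\mathcal H^{\alpha,r}$, $j_{(t,k)}\in\{1,\dots,d\}$ and $A_1,\dots,A_T$ pairwise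 disjoint. For such a representation of $C$ and $\xi>0$ let $$B_\xi=\bigcap_{t=1}^T\Big(([0,1]^d\setminus A_t)\cup\{x\in A_t:\ x_{j_{(t,k)}}-g_{(t,k)}(x_{-j_{(t,k)}})>\xi\ \text{ for all } k\}\Big).$$ Let $\mathcal F^{\mathrm{DNN}}(L,N,S,B,F)$ be the set of real-valued functions on $\mathbb R^d$ that are computed by a fully connected feed-forward network with ReLU activation and affine output layer that has at most $L$ hidden layers, at most $N$ nodes in each hidden layer, at most $S$ nonzero parameters (weights and biases), all parameters bounded by $B$ in absolute value, and output bounded by $F$ in absolute value on $[0,1]^d$. **Proposition.** There are positive constants $L_0,N_0,S_0,B_0,b_0$ and $\xi_0$, depending only on $d,\alpha,r,K,T$, such that for every $C\in\mathcal C^{\alpha,r,K,T}$ with a representation as above and every $0<\xi\le\xi_0$ there is $$f\in\mathcal F^{\mathrm{DNN}}\left(L_0\log(1/\xi),\ N_0\,\xi^{-(d-1)/\alpha},\ S_0\,\xi^{-(d-1)/\alpha}\log(1/\xi),\ B_0\,\xi^{-b_0},\ 1\right)$$ with $f(x)=C(x)$ for every $x\in B_\xi$. -/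

import Mathlib

open scoped NNReal ENNReal Matrix

noncomputable section

/-- The unit cube `[0,1]^n`. -/
def unitCube (n : ℕ) : Set (Fin n → ℝ) := Set.Icc 0 1

/-! ### Hölder balls on the unit cube -/

/-- `[α]⁻ = ⌈α - 1⌉`, the largest integer strictly smaller than `α` (for `α > 0`). -/
def holderOrder (α : ℝ) : ℕ := ⌈α - 1⌉₊

/-- The partial derivative of `g` on the cube in the coordinate directions `v 0, …, v (k - 1)`
(one-sided at the boundary). As `v` ranges over all `k`-tuples of coordinates, this ranges over all
`∂^m g` with `|m| = k`. -/
def cubePartial {n : ℕ} (g : (Fin n → ℝ) → ℝ) (k : ℕ) (v : Fin k → Fin n) (x : Fin n → ℝ) : ℝ :=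
  iteratedFDerivWithin ℝ k g (unitCube n) x (fun i => Pi.single (v i) 1)

/-- The Hölder norm of order `α` on `[0,1]^n`, with values in `[0, ∞]`: the largest sup norm of a
partial derivative of order at most `[α]⁻`, plus the largest Hölder seminorm of exponent
`α - [α]⁻ ∈ (0,1]`, for the Euclidean distance, of a partial derivative of order `[α]⁻`. -/
def holderNorm {n : ℕ} (α : ℝ) (g : (Fin n → ℝ) → ℝ) : ℝ≥0∞ :=
  (⨆ (k : ℕ) (_ : k ≤ holderOrder α) (v : Fin k → Fin n) (x ∈ unitCube n),
    ENNReal.ofReal |cubePartial g k v x|) +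
  (⨆ (v : Fin (holderOrder α) → Fin n) (x ∈ unitCube n) (y ∈ unitCube n) (_ : x ≠ y),
    ENNReal.ofReal (|cubePartial g (holderOrder α) v x - cubePartial g (holderOrder α) v y| /
      ‖WithLp.toLp 2 (x - y)‖ ^ (α - holderOrder α)))

/-- The closed ball of radius `r` in the Hölder space of order `α` on `[0,1]^n`. Only the values
of `g` on the cube matter. -/
def holderBall (n : ℕ) (α r : ℝ) : Set ((Fin n → ℝ) → ℝ) :=
  {g | ContDiffOn ℝ (holderOrder α) g (unitCube n) ∧ holderNorm α g ≤ ENNReal.ofReal r}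

/-! ### Piecewise constant classifiers with smooth boundaries on `[0,1]^(n+1)` -/

/-- The basis piece `{x ∈ [0,1]^(n+1) : x_j ≥ g(x_{-j})}`, where `x_{-j}` is `x` without its
`j`-th coordinate. -/
def basisPiece {n : ℕ} (g : (Fin n → ℝ) → ℝ) (j : Fin (n + 1)) : Set (Fin (n + 1) → ℝ) :=
  {x ∈ unitCube (n + 1) | g (j.removeNth x) ≤ x j}

/-- A piece: the intersection of `K` basis pieces. -/
def piece {n K : ℕ} (g : Fin K → (Fin n → ℝ) → ℝ) (j : Fin K → Fin (n + 1)) :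
    Set (Fin (n + 1) → ℝ) :=
  ⋂ k, basisPiece (g k) (j k)

/-- `T` pairwise disjoint pieces in `[0,1]^(n+1)`, each one given by `K` boundary functions
`g t k` in the Hölder ball of order `α` and radius `r` and by coordinates `j t k`. -/
structure SmoothPieces (n : ℕ) (α r : ℝ) (K T : ℕ) where
  g : Fin T → Fin K → (Fin n → ℝ) → ℝ
  j : Fin T → Fin K → Fin (n + 1)
  g_mem : ∀ t k, g t k ∈ holderBall n α r
  disjoint : Pairwise fun s t => Disjoint (piece (g s) (j s)) (piece (g t) (j t))

namespace SmoothPieces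

variable {n : ℕ} {α r : ℝ} {K T : ℕ}

/-- The piece `A_t`. -/
def A (P : SmoothPieces n α r K T) (t : Fin T) : Set (Fin (n + 1) → ℝ) := piece (P.g t) (P.j t)

/-- The classifier `C = 2 ∑_t 1_{A_t} - 1`. The class `𝒞^{α,r,K,T}` consists of the functions
`P.classifier`, restricted to the cube, for `P : SmoothPieces n α r K T`. -/
def classifier (P : SmoothPieces n α r K T) (x : Fin (n + 1) → ℝ) : ℝ :=
  2 * (∑ t, (P.A t).indicator (fun _ => (1 : ℝ)) x) - 1

/-- The set `B_ξ` of those `x ∈ [0,1]^(n+1)` such that, for every `t`, either `x ∉ A_t`, or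
`x ∈ A_t` and `x_{j(t,k)} - g_{t,k}(x_{-j(t,k)}) > ξ` for all `k`. -/
def B (P : SmoothPieces n α r K T) (ξ : ℝ) : Set (Fin (n + 1) → ℝ) :=
  {x ∈ unitCube (n + 1) | ∀ t, x ∉ P.A t ∨
    (x ∈ P.A t ∧ ∀ k, ξ < x (P.j t k) - P.g t k ((P.j t k).removeNth x))}

end SmoothPieces

/-! ### ReLU networks -/

/-- The parameters of a fully connected ReLU network with `o` outputs; the index is the input
dimension. A network is an affine output layer, or a hidden layer with weight matrix `W` and bias
`b`, whose outputs are fed to a further network. -/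
inductive ReLUNet (o : ℕ) : ℕ → Type
  | output {m : ℕ} (W : Matrix (Fin o) (Fin m) ℝ) (b : Fin o → ℝ) : ReLUNet o m
  | hidden {m p : ℕ} (W : Matrix (Fin p) (Fin m) ℝ) (b : Fin p → ℝ) (rest : ReLUNet o p) :
      ReLUNet o m

namespace ReLUNet

/-- The function computed by the network. -/
def eval {o : ℕ} : {m : ℕ} → ReLUNet o m → (Fin m → ℝ) → (Fin o → ℝ)
  | _, output W b, x => W *ᵥ x + b
  | _, hidden W b rest, x => rest.eval fun i => max ((W *ᵥ x + b) i) 0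

/-- The number of (hidden) layers. -/
def depth {o : ℕ} : {m : ℕ} → ReLUNet o m → ℕ
  | _, output _ _ => 0
  | _, hidden _ _ rest => rest.depth + 1

/-- The maximal number of nodes in a (hidden) layer. -/
def width {o : ℕ} : {m : ℕ} → ReLUNet o m → ℕ
  | _, output _ _ => 0
  | _, hidden (p := p) _ _ rest => max p rest.width

/-- The number of nonzero parameters (weights and biases, output layer included). -/
def numNonzero {o : ℕ} : {m : ℕ} → ReLUNet o m → ℕ
  | _, output W b => (∑ i, hammingNorm (W i)) + hammingNorm b
  | _, hidden W b rest => (∑ i, hammingNorm (W i)) + hammingNorm b + rest.numNonzero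

/-- The largest absolute value of a parameter (weights and biases, output layer included). -/
def maxParam {o : ℕ} : {m : ℕ} → ReLUNet o m → ℝ≥0
  | _, output W b =>
      max (Finset.univ.sup fun i => Finset.univ.sup fun k => ‖W i k‖₊)
        (Finset.univ.sup fun i => ‖b i‖₊)
  | _, hidden W b rest =>
      max (max (Finset.univ.sup fun i => Finset.univ.sup fun k => ‖W i k‖₊)
        (Finset.univ.sup fun i => ‖b i‖₊)) rest.maxParam

end ReLUNet

/-- The class `ℱ^DNN(L, N, S, B, F)` of real-valued functions computed by ReLU networks with `d`
inputs, at most `L` layers, at most `N` nodes in each layer, at most `S` nonzero parameters, all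
parameters at most `B` in absolute value, and sup norm on `[0,1]^d` at most `F`. -/
def dnnClass (d : ℕ) (L N S B F : ℝ) : Set ((Fin d → ℝ) → ℝ) :=
  {f | ∃ Θ : ReLUNet 1 d, (Θ.depth : ℝ) ≤ L ∧ (Θ.width : ℝ) ≤ N ∧ (Θ.numNonzero : ℝ) ≤ S ∧
    (Θ.maxParam : ℝ) ≤ B ∧ (∀ x ∈ unitCube d, |Θ.eval x 0| ≤ F) ∧ f = fun x => Θ.eval x 0}

end

/-!
Every boundary function `g` of Hölder order `α` is approximated uniformly by a ReLU network within
`ξ / 4`. The set `B_ξ` leaves a margin `ξ` inside the pieces only, so a ramp that rises while the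
approximation of `x_j - g(x_{-j})` runs from `ξ / 4` to `3 ξ / 4` agrees with the indicator of the
basis piece at the points that matter: it vanishes wherever `x_j < g(x_{-j})`, and is `1` wherever
`x_j - g(x_{-j}) > ξ`. One more layer, `max (∑ ramps - (K - 1)) 0`, intersects the basis pieces.
Since this value is nonzero at points of `A_t` only and the `A_t` are disjoint, the output is
bounded by `1` on the whole cube (`SmoothPieces.exists_mem_dnnClass`).

The approximation of `g` localizes Taylor polynomials at the points of a grid of mesh `1 / M`,
`M ~ ξ ^ (-1 / α)`, by a partition of unity into products of hat functions (`exists_local_approx`).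
After expansion into monomials, every term, and the coordinate `x_j` too, is a product of a fixed
number of factors `max (1 - |s|) 0` with `s` affine in `x`. All terms, of which there are
`O(M ^ n) = O(ξ ^ (-n / α))`, hence run through identical copies of one network of bounded width;
only the first layer and the final linear combination differ
(`exists_hiddenLayers_prod_hat`, `HiddenLayers.replicate`). The block-diagonal form of
the copies is what keeps the number of nonzero parameters linear in the number of terms.

Products are formed one factor at a time. The identity `a b = s - 1 / 4 - (s - s ^ 2) + (t - t ^ 2)`
with `s = (a + b) / 2` and `t = (1 + a - b) / 2` reduces them to the parabola `z - z ^ 2`, which is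
self-similar under the tent map (`sub_sq_eq_tentMap`). Iterating one fixed layer `k` times thus
gives the product up to `4 ^ (-k)` (`mulStep_spec`). As `k` of the order `log (1 / ξ)` makes this
error smaller than any given power of `ξ`, the crude bound by the sum of the errors of all terms
suffices.
-/

/-! ### Compositions of ReLU layers -/

/-- The number of nonzero entries of a weight matrix and a bias vector. -/
noncomputable def layerNonzero {m p : Type} [Fintype m] [Fintype p] (W : Matrix p m ℝ)
    (b : p → ℝ) : ℕ :=
  (∑ i, hammingNorm (W i)) + hammingNorm b

/-- `HiddenLayers N B L S f` says that `f` is a composition of `L` ReLU layers with at most `N`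
nodes each, with at most `S` nonzero parameters in total and with all parameters bounded by `B`.
Layers are indexed by arbitrary finite types. There is no affine output layer, so the values of
`f` can be fed to further layers without merging affine maps. -/
inductive HiddenLayers (N : ℕ) (B : ℝ≥0) : ∀ {m p : Type} [Fintype m] [Fintype p],
    ℕ → ℕ → ((m → ℝ) → p → ℝ) → Prop
  | id {m : Type} [Fintype m] (S : ℕ) : HiddenLayers N B 0 S (fun x : m → ℝ => x)
  | snoc {m p q : Type} [Fintype m] [Fintype p] [Fintype q] {L S s : ℕ}
      {f : (m → ℝ) → p → ℝ} (hf : HiddenLayers N B L S f) (W : Matrix q p ℝ) (b : q → ℝ)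
      (hq : Fintype.card q ≤ N) (hW : ∀ i k, ‖W i k‖₊ ≤ B) (hb : ∀ i, ‖b i‖₊ ≤ B)
      (hs : layerNonzero W b ≤ s) :
      HiddenLayers N B (L + 1) (S + s) (fun x i => max ((W *ᵥ f x + b) i) 0)

namespace HiddenLayers

variable {N L L' S S' : ℕ} {B : ℝ≥0} {m p q : Type} [Fintype m] [Fintype p] [Fintype q]

theorem mono {f : (m → ℝ) → p → ℝ} (hf : HiddenLayers N B L S f) {N' : ℕ} {B' : ℝ≥0}
    (hN : N ≤ N') (hB : B ≤ B') : HiddenLayers N' B' L S f := by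
  induction hf with
  | id S => exact .id S
  | snoc _ W b hq hW hb hs ih =>
    exact ih.snoc W b (hq.trans hN) (fun i k => (hW i k).trans hB) (fun i => (hb i).trans hB) hs

theorem of_le {f : (m → ℝ) → p → ℝ} (hf : HiddenLayers N B L S f) (hL : L = L') (hS : S ≤ S') :
    HiddenLayers N B L' S' f := by
  subst hL
  induction hf generalizing S' with
  | id => exact .id _
  | snoc hf W b hq hW hb hs ih =>
    obtain ⟨t, rfl⟩ := Nat.exists_eq_add_of_le hS
    rw [add_assoc]
    exact hf.snoc W b hq hW hb (hs.trans (Nat.le_add_right _ _))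

theorem comp {g : (p → ℝ) → q → ℝ} {f : (m → ℝ) → p → ℝ} (hg : HiddenLayers N B L' S' g)
    (hf : HiddenLayers N B L S f) : HiddenLayers N B (L + L') (S + S') (fun x => g (f x)) := by
  induction hg with
  | id S' => exact hf.of_le rfl (Nat.le_add_right _ _)
  | snoc _ W b hq hW hb hs ih =>
    rw [← add_assoc, ← add_assoc]
    exact (ih hf).snoc W b hq hW hb hs

theorem iterate {f : (m → ℝ) → m → ℝ} (hf : HiddenLayers N B L S f) (k : ℕ) :
    HiddenLayers N B (k * L) (k * S) f^[k] := by
  induction k with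
  | zero => rw [Nat.zero_mul, Nat.zero_mul]; exact HiddenLayers.id 0
  | succ k ih =>
    rw [Function.iterate_succ', Nat.succ_mul, Nat.succ_mul]
    exact hf.comp ih

end HiddenLayers

theorem layerNonzero_le {m p : Type} [Fintype m] [Fintype p] (W : Matrix p m ℝ) (b : p → ℝ) :
    layerNonzero W b ≤ Fintype.card p * (Fintype.card m + 1) := by
  have h1 : ∑ i, hammingNorm (W i) ≤ Fintype.card p * Fintype.card m := by
    refine (Finset.sum_le_card_nsmul _ _ (Fintype.card m)
      fun i _ => hammingNorm_le_card_fintype).trans ?_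
    simp
  have h2 : hammingNorm b ≤ Fintype.card p := hammingNorm_le_card_fintype
  unfold layerNonzero
  linarith

theorem hammingNorm_eq_sum {a : Type} [Fintype a] (w : a → ℝ) :
    hammingNorm w = ∑ i, if w i ≠ 0 then 1 else 0 := by
  simp only [hammingNorm, Finset.card_filter]

theorem hammingNorm_block {ι p : Type} [Fintype ι] [DecidableEq ι] [Fintype p] (a : ι)
    (w : p → ℝ) : hammingNorm (fun c : ι × p => if a = c.1 then w c.2 else 0) = hammingNorm w := by
  rw [hammingNorm_eq_sum, hammingNorm_eq_sum, Fintype.sum_prod_type, Finset.sum_eq_single a]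
  · simp
  · intro c _ hc
    simp [Ne.symm hc]
  · simp

/-- Replicating layers block-diagonally, once for each index in `ι`. -/
theorem HiddenLayers.replicate {N L S : ℕ} {B : ℝ≥0} {m p : Type} [Fintype m] [Fintype p]
    (ι : Type) [Fintype ι] {f : (m → ℝ) → p → ℝ} (hf : HiddenLayers N B L S f) :
    HiddenLayers (Fintype.card ι * N) B L (Fintype.card ι * S)
      (fun (X : ι × m → ℝ) (i : ι × p) => f (fun j => X (i.1, j)) i.2) := by
  classical
  induction hf with
  | id S => exact .id _
  | @snoc p q _ _ _ L S s f hf W b hq hW hb hs ih =>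
    have key := ih.snoc
      (Matrix.of fun (a : ι × q) (c : ι × p) => if a.1 = c.1 then W a.2 c.2 else 0)
      (fun a => b a.2) (s := Fintype.card ι * s) ?_ ?_ ?_ ?_
    · rw [mul_add]
      convert key using 5 with X i
      simp only [Pi.add_apply, Matrix.mulVec, dotProduct, Matrix.of_apply, Fintype.sum_prod_type]
      rw [Finset.sum_eq_single i.1]
      · simp
      · intro c _ hc
        simp [Ne.symm hc]
      · simp
    · rw [Fintype.card_prod]
      exact Nat.mul_le_mul_left _ hq
    · rintro a c
      simp only [Matrix.of_apply]
      split_ifs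
      · exact hW _ _
      · simp
    · exact fun a => hb _
    · refine le_trans (le_of_eq ?_) (Nat.mul_le_mul_left _ hs)
      have h1 : ∀ a : ι × q, hammingNorm ((Matrix.of fun (a : ι × q) (c : ι × p) =>
          if a.1 = c.1 then W a.2 c.2 else 0) a) = hammingNorm (W a.2) :=
        fun a => hammingNorm_block a.1 (W a.2)
      have h2 : hammingNorm (fun a : ι × q => b a.2) = Fintype.card ι * hammingNorm b := by
        rw [hammingNorm_eq_sum, Fintype.sum_prod_type]
        exact (Finset.sum_congr rfl fun x _ => (hammingNorm_eq_sum b).symm).trans (by simp)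
      unfold layerNonzero
      rw [h2, Finset.sum_congr rfl fun a _ => h1 a, Fintype.sum_prod_type]
      simp [mul_add]

/-! ### Affine functionals and dense layers -/

/-- An affine functional with all coefficients bounded by `B`. -/
def AffineBounded {m : Type} [Fintype m] (B : ℝ≥0) (f : (m → ℝ) → ℝ) : Prop :=
  ∃ (w : m → ℝ) (b : ℝ), (∀ k, ‖w k‖₊ ≤ B) ∧ ‖b‖₊ ≤ B ∧ ∀ x, f x = w ⬝ᵥ x + b

namespace AffineBounded

variable {m : Type} [Fintype m] {B B' : ℝ≥0} {f g : (m → ℝ) → ℝ}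

theorem mono (hf : AffineBounded B f) (h : B ≤ B') : AffineBounded B' f := by
  obtain ⟨w, b, hw, hb, e⟩ := hf
  exact ⟨w, b, fun k => (hw k).trans h, hb.trans h, e⟩

theorem const (c : ℝ) : AffineBounded (m := m) ‖c‖₊ fun _ => c :=
  ⟨0, c, by simp, le_rfl, by simp⟩

theorem coord (i : m) : AffineBounded 1 fun x : m → ℝ => x i := by
  classical
  refine ⟨Pi.single i 1, 0, fun k => ?_, by simp, by simp⟩
  by_cases h : k = i
  · subst h; simp
  · simp [h]

theorem add (hf : AffineBounded B f) (hg : AffineBounded B' g) :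
    AffineBounded (B + B') fun x => f x + g x := by
  obtain ⟨w, b, hw, hb, e⟩ := hf
  obtain ⟨w', b', hw', hb', e'⟩ := hg
  refine ⟨w + w', b + b', fun k => (nnnorm_add_le _ _).trans (add_le_add (hw k) (hw' k)),
    (nnnorm_add_le _ _).trans (add_le_add hb hb'), fun x => ?_⟩
  simp only [e, e', add_dotProduct]
  ring

theorem smul (c : ℝ) (hf : AffineBounded B f) : AffineBounded (‖c‖₊ * B) fun x => c * f x := by
  obtain ⟨w, b, hw, hb, e⟩ := hf
  refine ⟨c • w, c * b, fun k => ?_, ?_, fun x => ?_⟩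
  · simpa using mul_le_mul_right (hw k) ‖c‖₊
  · simpa using mul_le_mul_right hb ‖c‖₊
  · simp [e, smul_dotProduct, mul_add]

theorem neg (hf : AffineBounded B f) : AffineBounded B fun x => -f x := by
  simpa using hf.smul (-1)

theorem sub (hf : AffineBounded B f) (hg : AffineBounded B' g) :
    AffineBounded (B + B') fun x => f x - g x := by
  simpa [sub_eq_add_neg] using hf.add hg.neg

end AffineBounded

/-- A single layer with affine pre-activations; all its parameters are counted as nonzero. -/
theorem HiddenLayers.dense {N : ℕ} {B : ℝ≥0} {m p : Type} [Fintype m] [Fintype p]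
    {F : (m → ℝ) → p → ℝ} (hF : ∀ i, AffineBounded B fun x => F x i) (hp : Fintype.card p ≤ N) :
    HiddenLayers N B 1 (Fintype.card p * (Fintype.card m + 1)) fun x i => max (F x i) 0 := by
  choose w b hw hb e using hF
  have key := (HiddenLayers.id (N := N) (B := B) (m := m) 0).snoc (Matrix.of w) b hp
    (fun i k => hw i k) hb (layerNonzero_le _ _)
  rw [zero_add, zero_add] at key
  convert key using 4 with x i
  exact e i x

/-! ### From compositions of layers to networks -/

theorem hammingNorm_comp_equiv {a b : Type} [Fintype a] [Fintype b] (e : a ≃ b) (w : b → ℝ) :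
    hammingNorm (fun i => w (e i)) = hammingNorm w := by
  simp only [hammingNorm, Finset.card_filter]
  exact Equiv.sum_comp e fun i => if w i ≠ 0 then 1 else 0

/-- Layers can be put in front of any network, once the types indexing their nodes are
enumerated. -/
theorem HiddenLayers.exists_net {N L S : ℕ} {B : ℝ≥0} {m p : Type} [Fintype m] [Fintype p]
    {f : (m → ℝ) → p → ℝ} (hf : HiddenLayers N B L S f) {a : ℕ} (em : Fin a ≃ m) :
    ∃ (b : ℕ) (ep : Fin b ≃ p), ∀ {o : ℕ} (Θ : ReLUNet o b),
      ∃ Θ' : ReLUNet o a, Θ'.depth ≤ L + Θ.depth ∧ Θ'.width ≤ max N Θ.width ∧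
        Θ'.numNonzero ≤ S + Θ.numNonzero ∧ Θ'.maxParam ≤ max B Θ.maxParam ∧
        ∀ x : m → ℝ, Θ'.eval (fun i => x (em i)) = Θ.eval (fun i => f x (ep i)) := by
  induction hf with
  | id => exact ⟨a, em, fun Θ => ⟨Θ, by simp, by simp, by simp, by simp, fun x => rfl⟩⟩
  | @snoc p q _ _ _ L S s f hf W c hq hW hb hs ih =>
    obtain ⟨b, ep, h⟩ := ih
    refine ⟨_, (Fintype.equivFin q).symm, fun {o} Θ => ?_⟩
    set eq := (Fintype.equivFin q).symm with heq
    obtain ⟨Θ', h1, h2, h3, h4, h5⟩ := h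
      (.hidden (Matrix.of fun i k => W (eq i) (ep k)) (fun i => c (eq i)) Θ)
    refine ⟨Θ', ?_, ?_, ?_, ?_, ?_⟩
    · simp only [ReLUNet.depth] at h1
      omega
    · simp only [ReLUNet.width] at h2
      omega
    · simp only [ReLUNet.numNonzero] at h3
      have e1 : ∑ i, hammingNorm ((Matrix.of fun i k => W (eq i) (ep k)) i)
          = ∑ i, hammingNorm (W i) := by
        rw [← Equiv.sum_comp eq]
        exact Finset.sum_congr rfl fun i _ => hammingNorm_comp_equiv _ (W (eq i))
      rw [e1, hammingNorm_comp_equiv eq c] at h3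
      unfold layerNonzero at hs
      omega
    · refine h4.trans (max_le (le_max_left _ _) ?_)
      simp only [ReLUNet.maxParam]
      refine max_le (max_le ?_ ?_) (le_max_right _ _)
      · exact (Finset.sup_le fun i _ => Finset.sup_le fun k _ => hW _ _).trans (le_max_left _ _)
      · exact (Finset.sup_le fun i _ => hb _).trans (le_max_left _ _)
    · intro x
      rw [h5]
      simp only [ReLUNet.eval]
      congr 1
      ext i
      congr 1
      simp only [Pi.add_apply, Matrix.mulVec, dotProduct, Matrix.of_apply]
      rw [Equiv.sum_comp ep fun k => W (eq i) k * f x k]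

/-- Compositions of layers followed by one affine functional belong to the network class. -/
theorem HiddenLayers.mem_dnnClass {N L S d : ℕ} {B : ℝ≥0} {p : Type} [Fintype p]
    {f : (Fin d → ℝ) → p → ℝ} (hf : HiddenLayers N B L S f) {g : (p → ℝ) → ℝ}
    (hg : AffineBounded B g) {F L' N' S' B' : ℝ} (hF : ∀ x ∈ unitCube d, |g (f x)| ≤ F)
    (hL : (L : ℝ) ≤ L') (hN : (N : ℝ) ≤ N') (hS : ((S + Fintype.card p + 1 : ℕ) : ℝ) ≤ S')
    (hB : (B : ℝ) ≤ B') : (fun x => g (f x)) ∈ dnnClass d L' N' S' B' F := by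
  obtain ⟨b, ep, h⟩ := hf.exists_net (Equiv.refl _)
  obtain ⟨w, c, hw, hc, e⟩ := hg
  obtain ⟨Θ, h1, h2, h3, h4, h5⟩ := h (o := 1)
    (.output (Matrix.of fun _ k => w (ep k)) (fun _ => c))
  have hev : ∀ x, Θ.eval x 0 = g (f x) := by
    intro x
    have := congrFun (h5 x) 0
    simp only [Equiv.refl_apply, ReLUNet.eval] at this
    rw [this, e]
    simp only [Pi.add_apply, Matrix.mulVec, dotProduct, Matrix.of_apply]
    rw [Equiv.sum_comp ep fun k => w k * f x k]
  have hbp : b = Fintype.card p := by simpa using Fintype.card_congr ep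
  refine ⟨Θ, ?_, ?_, ?_, ?_, fun x hx => (hev x) ▸ hF x hx, funext fun x => (hev x).symm⟩
  · simp only [ReLUNet.depth] at h1
    exact le_trans (by exact_mod_cast h1) hL
  · simp only [ReLUNet.width, Nat.max_zero] at h2
    exact le_trans (by exact_mod_cast h2) hN
  · refine le_trans ?_ hS
    have e1 : hammingNorm (fun k => w (ep k)) ≤ b := by
      simpa using hammingNorm_le_card_fintype (x := fun k => w (ep k))
    have e2 : hammingNorm (fun _ : Fin 1 => c) ≤ 1 := by
      simpa using hammingNorm_le_card_fintype (x := fun _ : Fin 1 => c)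
    simp only [ReLUNet.numNonzero, Finset.univ_unique, Finset.sum_singleton] at h3
    have e3 : hammingNorm ((Matrix.of fun (_ : Fin 1) k => w (ep k)) default) ≤ b := e1
    exact_mod_cast (by omega : Θ.numNonzero ≤ S + Fintype.card p + 1)
  · refine le_trans ?_ hB
    have : Θ.maxParam ≤ B := by
      refine h4.trans (max_le le_rfl ?_)
      simp only [ReLUNet.maxParam]
      exact max_le (Finset.sup_le fun i _ => Finset.sup_le fun k _ => hw _)
        (Finset.sup_le fun i _ => hc)
    exact_mod_cast this

/-! ### Approximate multiplication -/

/-- The tent map of the unit interval, in the form in which a ReLU layer computes it. -/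
noncomputable def tentMap (z : ℝ) : ℝ := 2 * z - 4 * max (z - 1 / 2) 0

theorem tentMap_nonneg {z : ℝ} (h0 : 0 ≤ z) (h1 : z ≤ 1) : 0 ≤ tentMap z := by
  unfold tentMap
  rcases max_cases (z - 1 / 2) 0 with ⟨h, _⟩ | ⟨h, _⟩ <;> rw [h] <;> linarith

theorem tentMap_le_one {z : ℝ} : tentMap z ≤ 1 := by
  unfold tentMap
  rcases max_cases (z - 1 / 2) 0 with ⟨h, _⟩ | ⟨h, _⟩ <;> rw [h] <;> linarith

/-- The self-similarity of the parabola `z - z ^ 2` under the tent map. -/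
theorem sub_sq_eq_tentMap (z : ℝ) :
    z - z ^ 2 = tentMap z / 4 + (tentMap z - tentMap z ^ 2) / 4 := by
  unfold tentMap
  rcases max_cases (z - 1 / 2) 0 with ⟨h, _⟩ | ⟨h, _⟩ <;> rw [h] <;> ring

section Multiplication

variable {ι : Type}

/-- The state of the multiplication network: carried values `a` and `c`, and for each of the two
squares the current point `z` of the tent orbit, `max (z - 1 / 2) 0`, and an accumulator. -/
noncomputable def mulState (a : ι → ℝ) (c z A w A' : ℝ) : ι ⊕ Fin 7 → ℝ :=
  Sum.elim a ![c, z, max (z - 1 / 2) 0, A, w, max (w - 1 / 2) 0, A']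

/-- Pre-activations of the layer that prepares the squares of `(p + a i) / 2` and
`(1 + p - a i) / 2`. -/
noncomputable def mulInit (i : ι) (x : ι ⊕ Unit → ℝ) : ι ⊕ Fin 7 → ℝ :=
  Sum.elim (fun l => x (.inl l))
    ![1 / 2 * (x (.inr ()) + x (.inl i)),
      1 / 2 * (x (.inr ()) + x (.inl i)), 1 / 2 * (x (.inr ()) + x (.inl i)) - 1 / 2, 0,
      1 / 2 * (x (.inr ()) - x (.inl i)) + 1 / 2, 1 / 2 * (x (.inr ()) - x (.inl i)), 0]

/-- Pre-activations of the layer that advances both tent orbits and adds the new points to four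
times the accumulators. -/
noncomputable def mulIter (x : ι ⊕ Fin 7 → ℝ) : ι ⊕ Fin 7 → ℝ :=
  Sum.elim (fun l => x (.inl l))
    ![x (.inr 0),
      2 * x (.inr 1) - 4 * x (.inr 2), 2 * x (.inr 1) - 4 * x (.inr 2) - 1 / 2,
      4 * x (.inr 3) + (2 * x (.inr 1) - 4 * x (.inr 2)),
      2 * x (.inr 4) - 4 * x (.inr 5), 2 * x (.inr 4) - 4 * x (.inr 5) - 1 / 2,
      4 * x (.inr 6) + (2 * x (.inr 4) - 4 * x (.inr 5))]

/-- Pre-activations of the layer that computes one minus the approximate product; its ReLU and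
that of `mulClip` clip the product to the unit interval. -/
noncomputable def mulRead (k : ℕ) (x : ι ⊕ Fin 7 → ℝ) : ι ⊕ Unit → ℝ :=
  Sum.elim (fun l => x (.inl l))
    fun _ => 5 / 4 - x (.inr 0) + ((1 / 4) ^ k * x (.inr 3) - (1 / 4) ^ k * x (.inr 6))

/-- Pre-activations of the layer that replaces the last coordinate `t` by `1 - t`. -/
noncomputable def mulClip (x : ι ⊕ Unit → ℝ) : ι ⊕ Unit → ℝ :=
  Sum.elim (fun l => x (.inl l)) fun _ => 1 - x (.inr ())

/-- Coordinatewise positive part. -/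
noncomputable def reluMap {p : Type} (x : p → ℝ) : p → ℝ := fun i => max (x i) 0

/-- Multiplication of the last coordinate by the coordinate `i`, up to an error `(1 / 4) ^ k`. -/
noncomputable def mulStep (k : ℕ) (i : ι) (x : ι ⊕ Unit → ℝ) : ι ⊕ Unit → ℝ :=
  reluMap (mulClip (reluMap (mulRead k
    ((fun y => reluMap (mulIter y))^[k] (reluMap (mulInit i x))))))

theorem max_vecCons {n : ℕ} {x x' : ℝ} {v v' : Fin n → ℝ} (hx : max x 0 = x')
    (hv : ∀ l, max (v l) 0 = v' l) (l : Fin (n + 1)) :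
    max (Matrix.vecCons x v l) 0 = Matrix.vecCons x' v' l := by
  induction l using Fin.cases with
  | zero => exact hx
  | succ l => exact hv l

theorem AffineBounded.vecCons {m : Type} [Fintype m] {B : ℝ≥0} {n : ℕ} {f : (m → ℝ) → ℝ}
    {v : (m → ℝ) → Fin n → ℝ} (hf : AffineBounded B f)
    (hv : ∀ l, AffineBounded B fun x => v x l) (l : Fin (n + 1)) :
    AffineBounded B fun x => Matrix.vecCons (f x) (v x) l := by
  induction l using Fin.cases with
  | zero => exact hf
  | succ l => exact hv l

theorem reluMap_mulIter {a : ι → ℝ} (ha : ∀ l, 0 ≤ a l) {c z A w A' : ℝ} (hc : 0 ≤ c)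
    (hz : 0 ≤ z) (hz1 : z ≤ 1) (hw : 0 ≤ w) (hw1 : w ≤ 1) (hA : 0 ≤ A) (hA' : 0 ≤ A') :
    reluMap (mulIter (mulState a c z A w A')) =
      mulState a c (tentMap z) (4 * A + tentMap z) (tentMap w) (4 * A' + tentMap w) := by
  have h1 := tentMap_nonneg hz hz1
  have h2 := tentMap_nonneg hw hw1
  ext (l | l)
  · simp [reluMap, mulIter, mulState, ha l]
  · have h3 : 0 ≤ 4 * A + tentMap z := by positivity
    have h4 : 0 ≤ 4 * A' + tentMap w := by positivity
    exact max_vecCons (max_eq_left hc) (max_vecCons (max_eq_left h1) (max_vecCons rfl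
      (max_vecCons (max_eq_left h3) (max_vecCons (max_eq_left h2) (max_vecCons rfl
      (max_vecCons (max_eq_left h4) finZeroElim)))))) l

theorem iterate_mulIter {a : ι → ℝ} (ha : ∀ l, 0 ≤ a l) {c z w : ℝ} (hc : 0 ≤ c)
    (hz : 0 ≤ z) (hz1 : z ≤ 1) (hw : 0 ≤ w) (hw1 : w ≤ 1) (k : ℕ) :
    ∃ z' A w' A', (fun y => reluMap (mulIter y))^[k] (mulState a c z 0 w 0) =
        mulState a c z' A w' A' ∧ 0 ≤ z' ∧ z' ≤ 1 ∧ 0 ≤ w' ∧ w' ≤ 1 ∧ 0 ≤ A ∧ 0 ≤ A' ∧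
      z - z ^ 2 = (1 / 4) ^ k * A + (1 / 4) ^ k * (z' - z' ^ 2) ∧
      w - w ^ 2 = (1 / 4) ^ k * A' + (1 / 4) ^ k * (w' - w' ^ 2) := by
  induction k with
  | zero => exact ⟨z, 0, w, 0, by simp, hz, hz1, hw, hw1, le_rfl, le_rfl, by simp, by simp⟩
  | succ k ih =>
    obtain ⟨z', A, w', A', e, hz', hz1', hw', hw1', hA, hA', e1, e2⟩ := ih
    have h1 := tentMap_nonneg hz' hz1'
    have h2 := tentMap_nonneg hw' hw1'
    refine ⟨tentMap z', 4 * A + tentMap z', tentMap w', 4 * A' + tentMap w', ?_, h1,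
      tentMap_le_one, h2, tentMap_le_one, by positivity, by positivity, ?_, ?_⟩
    · rw [Function.iterate_succ_apply', e]
      exact reluMap_mulIter ha hc hz' hz1' hw' hw1' hA hA'
    · rw [e1, sub_sq_eq_tentMap z']
      ring
    · rw [e2, sub_sq_eq_tentMap w']
      ring

theorem mulStep_spec (k : ℕ) (i : ι) {a : ι → ℝ} (ha : ∀ l, 0 ≤ a l) (ha1 : ∀ l, a l ≤ 1)
    {p : ℝ} (hp : 0 ≤ p) (hp1 : p ≤ 1) :
    ∃ p', mulStep k i (Sum.elim a fun _ => p) = Sum.elim a (fun _ => p') ∧ 0 ≤ p' ∧ p' ≤ 1 ∧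
      |p' - p * a i| ≤ (1 / 4) ^ k := by
  have hi := ha i
  have hi1 := ha1 i
  have h0 : reluMap (mulInit i (Sum.elim a fun _ => p)) =
      mulState a (1 / 2 * (p + a i)) (1 / 2 * (p + a i)) 0 (1 / 2 * (p - a i) + 1 / 2) 0 := by
    ext (l | l)
    · simp [reluMap, mulInit, mulState, ha l]
    · simp only [reluMap, mulInit, mulState, Sum.elim_inr, Sum.elim_inl]
      exact max_vecCons (max_eq_left (by linarith)) (max_vecCons (max_eq_left (by linarith))
        (max_vecCons rfl (max_vecCons (max_self 0) (max_vecCons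
        (max_eq_left (by linarith)) (max_vecCons (by congr 1; ring)
        (max_vecCons (max_self 0) finZeroElim)))))) l
  obtain ⟨z', A, w', A', e, hz', hz1', hw', hw1', hA, hA', e1, e2⟩ :=
    iterate_mulIter ha (c := 1 / 2 * (p + a i)) (z := 1 / 2 * (p + a i))
      (w := 1 / 2 * (p - a i) + 1 / 2) (by linarith) (by linarith) (by linarith) (by linarith)
      (by linarith) k
  set δ : ℝ := (1 / 4) ^ k with hδ
  have hδ0 : 0 ≤ δ := by positivity
  set v : ℝ := 5 / 4 - 1 / 2 * (p + a i) + (δ * A - δ * A') with hv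
  refine ⟨max (1 - max v 0) 0, ?_, le_max_right _ _, ?_, ?_⟩
  · unfold mulStep
    rw [h0, e]
    ext (l | l)
    · simp [reluMap, mulRead, mulClip, mulState, ha l]
    · simp [reluMap, mulRead, mulClip, mulState, hv, hδ]
  · exact max_le (by linarith [le_max_right v 0]) zero_le_one
  · have hpa : 0 ≤ p * a i := mul_nonneg hp hi
    have hpa1 : p * a i ≤ 1 := mul_le_one₀ hp1 hi hi1
    -- `a b = s - 1 / 4 - (s - s ^ 2) + (t - t ^ 2)` for `s = (a + b) / 2`, `t = (1 + a - b) / 2`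
    have herr : 1 - v - p * a i = δ * (z' - z' ^ 2) - δ * (w' - w' ^ 2) := by
      rw [hv]
      linear_combination e1 - e2
    have b1 : δ * (z' - z' ^ 2) ≤ δ * 1 := mul_le_mul_of_nonneg_left (by nlinarith) hδ0
    have b2 : δ * (w' - w' ^ 2) ≤ δ * 1 := mul_le_mul_of_nonneg_left (by nlinarith) hδ0
    have b3 : 0 ≤ δ * (z' - z' ^ 2) := mul_nonneg hδ0 (by nlinarith)
    have b4 : 0 ≤ δ * (w' - w' ^ 2) := mul_nonneg hδ0 (by nlinarith)
    rw [abs_le]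
    rcases max_cases v 0 with ⟨h, _⟩ | ⟨h, _⟩ <;> rw [h] <;>
      rcases max_cases (1 - v) 0 with ⟨h', _⟩ | ⟨h', _⟩ <;>
      constructor <;> first | (rw [h']; linarith) | (norm_num; linarith)

/-- Successive multiplication of the last coordinate by the coordinates in a list. -/
noncomputable def mulList (k : ℕ) (l : List ι) (x : ι ⊕ Unit → ℝ) : ι ⊕ Unit → ℝ :=
  l.foldr (mulStep k) x

theorem mulList_spec (k : ℕ) {a : ι → ℝ} (ha : ∀ l, 0 ≤ a l) (ha1 : ∀ l, a l ≤ 1) (l : List ι) :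
    ∃ p, mulList k l (Sum.elim a fun _ => 1) = Sum.elim a (fun _ => p) ∧ 0 ≤ p ∧ p ≤ 1 ∧
      |p - (l.map a).prod| ≤ l.length * (1 / 4) ^ k := by
  induction l with
  | nil => exact ⟨1, rfl, zero_le_one, le_rfl, by simp⟩
  | cons i l ih =>
    obtain ⟨p, e, hp, hp1, herr⟩ := ih
    obtain ⟨p', e', hp', hp1', herr'⟩ := mulStep_spec k i ha ha1 hp hp1
    refine ⟨p', ?_, hp', hp1', ?_⟩
    · rw [← e', ← e]
      rfl
    · rw [List.map_cons, List.prod_cons, List.length_cons]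
      have h1 : p' - a i * (l.map a).prod = (p' - p * a i) + a i * (p - (l.map a).prod) := by ring
      have h2 : |a i * (p - (l.map a).prod)| ≤ 1 * (l.length * (1 / 4) ^ k) := by
        rw [abs_mul, abs_of_nonneg (ha i)]
        exact mul_le_mul (ha1 i) herr (abs_nonneg _) zero_le_one
      rw [h1]
      refine (abs_add_le _ _).trans ?_
      push_cast
      linarith

variable [Fintype ι]

theorem hiddenLayers_mulStep {B : ℝ≥0} (hB : 16 ≤ B) (k : ℕ) (i : ι) :
    HiddenLayers (Fintype.card ι + 7) B (k + 3)
      ((k + 3) * ((Fintype.card ι + 7) * (Fintype.card ι + 8))) (mulStep k i) := by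
  have c1 : ∀ j : ι ⊕ Fin 7, AffineBounded 1 fun x : ι ⊕ Fin 7 → ℝ => x j := .coord
  have c2 : ∀ j : ι ⊕ Unit, AffineBounded 1 fun x : ι ⊕ Unit → ℝ => x j := .coord
  have hB1 : 1 ≤ B := le_trans (by rw [← NNReal.coe_le_coe]; norm_num) hB
  have h1 := HiddenLayers.dense (N := Fintype.card ι + 7) (B := B) (F := mulInit i) (by
    rintro (l | l)
    · exact (c2 (.inl l)).mono hB1
    have s1 := ((c2 (.inr ())).add (c2 (.inl i))).smul (1 / 2)
    have s2 := ((c2 (.inr ())).sub (c2 (.inl i))).smul (1 / 2)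
    exact .vecCons (s1.mono (le_trans (by rw [← NNReal.coe_le_coe]; norm_num) hB))
      (.vecCons (s1.mono (le_trans (by rw [← NNReal.coe_le_coe]; norm_num) hB))
      (.vecCons ((s1.sub (.const (1 / 2))).mono
        (le_trans (by rw [← NNReal.coe_le_coe]; norm_num) hB))
      (.vecCons ((AffineBounded.const 0).mono (by simp))
      (.vecCons ((s2.add (.const (1 / 2))).mono
        (le_trans (by rw [← NNReal.coe_le_coe]; norm_num) hB))
      (.vecCons (s2.mono (le_trans (by rw [← NNReal.coe_le_coe]; norm_num) hB))
      (.vecCons ((AffineBounded.const 0).mono (by simp)) finZeroElim)))))) l) (by simp)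
  have h2 := HiddenLayers.dense (N := Fintype.card ι + 7) (B := B) (F := mulIter (ι := ι)) (by
    rintro (l | l)
    · exact (c1 (.inl l)).mono hB1
    have s1 := ((c1 (.inr 1)).smul 2).sub ((c1 (.inr 2)).smul 4)
    have s2 := ((c1 (.inr 4)).smul 2).sub ((c1 (.inr 5)).smul 4)
    exact .vecCons ((c1 (.inr 0)).mono hB1)
      (.vecCons (s1.mono (le_trans (by rw [← NNReal.coe_le_coe]; norm_num) hB))
      (.vecCons ((s1.sub (.const (1 / 2))).mono
        (le_trans (by rw [← NNReal.coe_le_coe]; norm_num) hB))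
      (.vecCons ((((c1 (.inr 3)).smul 4).add s1).mono
        (le_trans (by rw [← NNReal.coe_le_coe]; norm_num) hB))
      (.vecCons (s2.mono (le_trans (by rw [← NNReal.coe_le_coe]; norm_num) hB))
      (.vecCons ((s2.sub (.const (1 / 2))).mono
        (le_trans (by rw [← NNReal.coe_le_coe]; norm_num) hB))
      (.vecCons ((((c1 (.inr 6)).smul 4).add s2).mono
        (le_trans (by rw [← NNReal.coe_le_coe]; norm_num) hB)) finZeroElim)))))) l) (by simp)
  have h3 := HiddenLayers.dense (N := Fintype.card ι + 7) (B := B) (F := mulRead (ι := ι) k) (by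
    rintro (l | l)
    · exact (c1 (.inl l)).mono hB1
    have hk : ‖((1 / 4) ^ k : ℝ)‖₊ ≤ 1 := by
      rw [nnnorm_pow]
      exact pow_le_one₀ (by simp) (by rw [← NNReal.coe_le_coe]; norm_num)
    have s := ((AffineBounded.const (5 / 4)).sub (c1 (.inr 0))).add
      (((c1 (.inr 3)).smul ((1 / 4) ^ k)).sub ((c1 (.inr 6)).smul ((1 / 4) ^ k)))
    refine s.mono (le_trans ?_ hB)
    calc _ ≤ ‖(5 / 4 : ℝ)‖₊ + 1 + (1 * 1 + 1 * 1) := by gcongr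
      _ ≤ 16 := by rw [← NNReal.coe_le_coe]; norm_num) (by simp)
  have h4 := HiddenLayers.dense (N := Fintype.card ι + 7) (B := B) (F := mulClip (ι := ι)) (by
    rintro (l | l)
    · exact (c2 (.inl l)).mono hB1
    exact ((AffineBounded.const 1).sub (c2 (.inr ()))).mono
      (le_trans (by rw [← NNReal.coe_le_coe]; norm_num) hB)) (by simp)
  have h := h4.comp (h3.comp ((h2.iterate k).comp h1))
  simp only [Fintype.card_sum, Fintype.card_fin, Fintype.card_unit] at h
  refine h.of_le (by ring) ?_
  generalize Fintype.card ι = c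
  have e1 : (c + 7) * (c + 1 + 1) ≤ (c + 7) * (c + 8) := Nat.mul_le_mul_left _ (by omega)
  have e2 : k * ((c + 7) * (c + 7 + 1)) ≤ k * ((c + 7) * (c + 8)) := le_rfl
  have e3 : (c + 1) * (c + 7 + 1) ≤ (c + 7) * (c + 8) := Nat.mul_le_mul (by omega) (by omega)
  have e4 : (c + 1) * (c + 1 + 1) ≤ (c + 7) * (c + 8) := Nat.mul_le_mul (by omega) (by omega)
  rw [add_mul k 3]
  omega

theorem hiddenLayers_mulList {B : ℝ≥0} (hB : 16 ≤ B) (k : ℕ) (l : List ι) :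
    HiddenLayers (Fintype.card ι + 7) B (l.length * (k + 3))
      (l.length * ((k + 3) * ((Fintype.card ι + 7) * (Fintype.card ι + 8)))) (mulList k l) := by
  induction l with
  | nil =>
    rw [List.length_nil, Nat.zero_mul, Nat.zero_mul]
    exact HiddenLayers.id 0
  | cons i l ih =>
    rw [List.length_cons, Nat.succ_mul, Nat.succ_mul]
    exact (hiddenLayers_mulStep hB k i).comp ih

/-- The values `1 - |t|`, computed from the positive and the negative parts of `t`, together with a
last coordinate `1` from which successive multiplication starts. -/
def hatPre (x : ι ⊕ ι → ℝ) : ι ⊕ Unit → ℝ :=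
  Sum.elim (fun l => 1 - x (.inl l) - x (.inr l)) fun _ => 1

/-- A family of products of hat functions `max (1 - |s|) 0` of affine functionals `s` is computed
up to an error exponentially small in `k` by layers whose number depends on `k` and on the number of
factors only, not on the number of products. -/
theorem exists_hiddenLayers_prod_hat {m I : Type} [Fintype m] [Fintype I] {B : ℝ≥0} (hB : 16 ≤ B)
    (s : I → ι → (m → ℝ) → ℝ) (hs : ∀ i l, AffineBounded B (s i l)) (k : ℕ) :
    ∃ Q : (m → ℝ) → I × (ι ⊕ Unit) → ℝ,
      HiddenLayers (Fintype.card I * (2 * Fintype.card ι + 7)) B (2 + Fintype.card ι * (k + 3))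
        (Fintype.card I * ((2 * Fintype.card ι + 8) ^ 2 *
          (Fintype.card m + 2 + Fintype.card ι * (k + 3)))) Q ∧
      ∀ x i, |Q x (i, .inr ()) - ∏ l, max (1 - |s i l x|) 0| ≤ Fintype.card ι * (1 / 4) ^ k := by
  set c := Fintype.card ι with hc
  have h1 := HiddenLayers.dense (N := Fintype.card I * (2 * c + 7)) (B := B)
    (F := fun (x : m → ℝ) (j : I × (ι ⊕ ι)) =>
      Sum.elim (fun l => s j.1 l x) (fun l => -s j.1 l x) j.2) (by
    rintro ⟨i, (l | l)⟩
    · exact hs i l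
    · exact (hs i l).neg) (by
    rw [Fintype.card_prod, Fintype.card_sum]
    exact Nat.mul_le_mul_left _ (by omega))
  have c1 : ∀ j : ι ⊕ ι, AffineBounded 1 fun x : ι ⊕ ι → ℝ => x j := .coord
  have h2 := (HiddenLayers.dense (N := 2 * c + 7) (B := B) (F := hatPre (ι := ι)) (by
    rintro (l | l)
    · exact (((AffineBounded.const 1).sub (c1 _)).sub (c1 _)).mono
        (le_trans (by rw [← NNReal.coe_le_coe]; norm_num) hB)
    · exact (AffineBounded.const 1).mono
        (le_trans (by rw [← NNReal.coe_le_coe]; norm_num) hB)) (by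
    rw [Fintype.card_sum, Fintype.card_unit]
    omega)).replicate I
  have h3 := ((hiddenLayers_mulList (ι := ι) hB k Finset.univ.toList).mono
    (by omega : Fintype.card ι + 7 ≤ 2 * c + 7) le_rfl).replicate I
  have h := h3.comp (h2.comp h1)
  simp only [Fintype.card_sum, Fintype.card_prod, Fintype.card_unit, Finset.length_toList,
    Finset.card_univ, ← hc] at h
  refine ⟨_, h.of_le (by ring) ?_, fun x i => ?_⟩
  · have e : (2 * c + 8) ^ 2 * (Fintype.card m + 2 + c * (k + 3)) =
        (2 * c + 8) ^ 2 * (Fintype.card m + 1) + (2 * c + 8) ^ 2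
          + c * ((k + 3) * (2 * c + 8) ^ 2) := by ring
    rw [mul_assoc, ← mul_add, ← mul_add, e]
    gcongr
    · nlinarith
    · nlinarith
    · nlinarith
  · set a : ι → ℝ := fun l => max (1 - |s i l x|) 0 with ha
    obtain ⟨p, e, hp, hp1, herr⟩ := mulList_spec k (a := a) (fun l => le_max_right _ _)
      (fun l => max_le (by linarith [abs_nonneg (s i l x)]) zero_le_one) Finset.univ.toList
    rw [Finset.length_toList, Finset.card_univ, ← hc, Finset.prod_map_toList] at herr
    convert herr using 3
    have := congrFun e (.inr ())
    rw [Sum.elim_inr] at this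
    rw [← this]
    congr 1
    ext (l | l)
    · simp only [hatPre, Sum.elim_inl, Sum.elim_inr, ha]
      congr 1
      rcases abs_cases (s i l x) with ⟨h, h'⟩ | ⟨h, h'⟩ <;> rw [h]
      · rw [max_eq_left h', max_eq_right (by linarith)]
        ring
      · rw [max_eq_right h'.le, max_eq_left (by linarith)]
        ring
    · simp [hatPre]

end Multiplication

/-! ### Local Taylor approximation of Hölder functions -/

theorem uniqueDiffOn_unitCube (n : ℕ) : UniqueDiffOn ℝ (unitCube n) := by
  unfold unitCube
  rw [← Set.pi_univ_Icc]
  exact UniqueDiffOn.univ_pi fun i => uniqueDiffOn_Icc zero_lt_one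

theorem unitCube_add_smul_mem {n : ℕ} {u y : Fin n → ℝ} (hu : u ∈ unitCube n)
    (hy : y ∈ unitCube n) {t : ℝ} (ht : t ∈ Set.Icc (0 : ℝ) 1) : u + t • (y - u) ∈ unitCube n :=
  (convex_Icc 0 1).add_smul_sub_mem hu hy ht

theorem abs_cubePartial_le {n : ℕ} {α r : ℝ} (hr : 0 ≤ r) {g : (Fin n → ℝ) → ℝ}
    (hg : g ∈ holderBall n α r) {k : ℕ} (hk : k ≤ holderOrder α) (v : Fin k → Fin n)
    {x : Fin n → ℝ} (hx : x ∈ unitCube n) : |cubePartial g k v x| ≤ r := by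
  have h := (le_add_of_nonneg_right zero_le).trans hg.2
  rw [← ENNReal.ofReal_le_ofReal_iff hr]
  refine le_trans ?_ h
  exact le_iSup₂_of_le k hk (le_iSup_of_le v (le_iSup₂_of_le x hx le_rfl))

theorem abs_cubePartial_sub_le {n : ℕ} {α r : ℝ} (hr : 0 ≤ r) {g : (Fin n → ℝ) → ℝ}
    (hg : g ∈ holderBall n α r) (v : Fin (holderOrder α) → Fin n)
    {x y : Fin n → ℝ} (hx : x ∈ unitCube n) (hy : y ∈ unitCube n) :
    |cubePartial g (holderOrder α) v x - cubePartial g (holderOrder α) v y| ≤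
      r * ‖WithLp.toLp 2 (x - y)‖ ^ (α - holderOrder α) := by
  by_cases hxy : x = y
  · subst hxy
    simp only [sub_self, abs_zero]
    positivity
  have h := (le_add_of_nonneg_left zero_le).trans hg.2
  have hpos : 0 < ‖WithLp.toLp 2 (x - y)‖ ^ (α - holderOrder α) := by
    refine Real.rpow_pos_of_pos (norm_pos_iff.2 fun h0 => hxy ?_) _
    have := congrArg (WithLp.ofLp) h0
    exact sub_eq_zero.1 this
  rw [← div_le_iff₀ hpos, ← ENNReal.ofReal_le_ofReal_iff hr]
  refine le_trans ?_ h
  exact le_iSup_of_le v (le_iSup₂_of_le x hx (le_iSup₂_of_le y hy (le_iSup_of_le hxy le_rfl)))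

/-- A Taylor bound for a chain of derivatives on `[0,1]`: if the last derivative in the chain
deviates from its value at `0` by at most `C`, so does the function from its Taylor polynomial. -/
theorem abs_sub_taylor_le_of_chain {C : ℝ} (hC : 0 ≤ C) (m : ℕ) (h : ℕ → ℝ → ℝ)
    (hd : ∀ k < m, ∀ t ∈ Set.Icc (0 : ℝ) 1,
      HasDerivWithinAt (h k) (h (k + 1) t) (Set.Icc 0 1) t)
    (hm : ∀ t ∈ Set.Icc (0 : ℝ) 1, |h m t - h m 0| ≤ C) :
    ∀ t ∈ Set.Icc (0 : ℝ) 1,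
      |h 0 t - ∑ k ∈ Finset.range (m + 1), t ^ k / k.factorial * h k 0| ≤ C := by
  induction m generalizing h with
  | zero => simpa using hm
  | succ m ih =>
    intro t ht
    have ih' := ih (fun k => h (k + 1)) (fun k hk => hd (k + 1) (by omega)) hm
    set e : ℝ → ℝ := fun t => h 0 t - ∑ k ∈ Finset.range (m + 1 + 1), t ^ k / k.factorial * h k 0
      with he
    have hde : ∀ s ∈ Set.Icc (0 : ℝ) 1, HasDerivWithinAt e
        (h 1 s - ∑ k ∈ Finset.range (m + 1), s ^ k / k.factorial * h (k + 1) 0)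
        (Set.Icc 0 1) s := by
      intro s hs
      refine (hd 0 (by omega) s hs).sub ?_
      simp_rw [Finset.sum_range_succ' (fun k => _ ^ k / (k.factorial : ℝ) * h k 0) (m + 1)]
      have hsum : HasDerivWithinAt
          (fun s : ℝ => ∑ k ∈ Finset.range (m + 1),
            s ^ (k + 1) / ((k + 1).factorial : ℝ) * h (k + 1) 0)
          (∑ k ∈ Finset.range (m + 1), s ^ k / k.factorial * h (k + 1) 0) (Set.Icc 0 1) s := by
        refine HasDerivWithinAt.fun_sum fun k _ => ?_
        have h1 := (((hasDerivAt_pow (k + 1) s).div_const ((k + 1).factorial : ℝ)).mul_const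
          (h (k + 1) 0)).hasDerivWithinAt (s := Set.Icc 0 1)
        convert h1 using 1
        have hk1 : ((k : ℝ) + 1) ≠ 0 := by positivity
        rw [Nat.factorial_succ]
        push_cast
        field_simp
      simpa using hsum.add_const (h 0 0)
    have hmv := (convex_Icc (0 : ℝ) 1).norm_image_sub_le_of_norm_hasDerivWithin_le
      (f := e) (C := C) hde (fun s hs => ih' s hs) (Set.left_mem_Icc.2 zero_le_one) ht
    have he0 : e 0 = 0 := by
      simp [he, Finset.sum_range_succ']
    rw [he0, sub_zero, sub_zero, Real.norm_eq_abs, Real.norm_eq_abs, abs_of_nonneg ht.1] at hmv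
    exact hmv.trans (mul_le_of_le_one_right hC ht.2)

/-- The value of the `k`-th derivative on the diagonal, in terms of partial derivatives. -/
theorem iteratedFDerivWithin_diag {n : ℕ} (g : (Fin n → ℝ) → ℝ) (k : ℕ) (x w : Fin n → ℝ) :
    iteratedFDerivWithin ℝ k g (unitCube n) x (fun _ => w) =
      ∑ v : Fin k → Fin n, (∏ i, w (v i)) * cubePartial g k v x := by
  conv_lhs => rw [pi_eq_sum_univ' w]
  rw [ContinuousMultilinearMap.map_sum]
  refine Finset.sum_congr rfl fun v _ => ?_
  rw [ContinuousMultilinearMap.map_smul_univ (iteratedFDerivWithin ℝ k g (unitCube n) x)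
    (fun i => w (v i)) fun i => Pi.single (v i) 1]
  rfl

/-- The Taylor polynomial of order `m` about `u`, summed over tuples of coordinates
instead of multi-indices. -/
noncomputable def cubeTaylor {n : ℕ} (g : (Fin n → ℝ) → ℝ) (m : ℕ) (u y : Fin n → ℝ) : ℝ :=
  ∑ k : Fin (m + 1), ∑ v : Fin k → Fin n,
    1 / ((k : ℕ).factorial : ℝ) * cubePartial g k v u * ∏ i, (y (v i) - u (v i))

theorem abs_sub_cubeTaylor_le {n : ℕ} {α r : ℝ} (hα : 0 < α) (hr : 0 ≤ r)
    {g : (Fin n → ℝ) → ℝ} (hg : g ∈ holderBall n α r) {u y : Fin n → ℝ} (hu : u ∈ unitCube n)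
    (hy : y ∈ unitCube n) {δ : ℝ} (hδ : 0 < δ) (hn : 0 < n) (hyu : ∀ i, |y i - u i| ≤ δ) :
    |g y - cubeTaylor g (holderOrder α) u y| ≤ r * (n * δ) ^ α := by
  set m := holderOrder α with hm
  have hs : 0 ≤ α - m := by
    have : (m : ℝ) < α ∨ m = 0 := by
      by_cases h1 : α ≤ 1
      · right
        rw [hm]
        exact Nat.ceil_eq_zero.2 (by linarith)
      · left
        have := Nat.ceil_lt_add_one (show 0 ≤ α - 1 by linarith)
        rw [hm]
        unfold holderOrder
        linarith
    rcases this with h | h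
    · linarith
    · rw [h]; simpa using hα.le
  set w := y - u with hw
  set h : ℕ → ℝ → ℝ := fun k t =>
    iteratedFDerivWithin ℝ k g (unitCube n) (u + t • w) (fun _ => w) with hh
  have hmem : ∀ t ∈ Set.Icc (0 : ℝ) 1, u + t • w ∈ unitCube n :=
    fun t ht => unitCube_add_smul_mem hu hy ht
  have hn1 : (0 : ℝ) < n := by exact_mod_cast hn
  have key := abs_sub_taylor_le_of_chain (C := r * (n * δ) ^ α) (by positivity) m h ?_ ?_ 1
    (Set.right_mem_Icc.2 zero_le_one)
  · convert key using 3
    · simp [hh, hw]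
    · rw [cubeTaylor, ← Fin.sum_univ_eq_sum_range (fun k => (1 : ℝ) ^ k / k.factorial * h k 0)]
      refine Finset.sum_congr rfl fun k _ => ?_
      simp only [hh, one_pow, zero_smul, add_zero, iteratedFDerivWithin_diag, Finset.mul_sum]
      refine Finset.sum_congr rfl fun v _ => ?_
      simp only [hw, Pi.sub_apply]
      ring
  · intro k hk t ht
    have h1 := (hg.1.differentiableOn_iteratedFDerivWithin (m := k) (by exact_mod_cast hk)
      (uniqueDiffOn_unitCube n) _ (hmem t ht)).hasFDerivWithinAt
    have h2 : HasDerivWithinAt (fun t : ℝ => u + t • w) w (Set.Icc 0 1) t := by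
      simpa using ((hasDerivAt_id t).smul_const w).hasDerivWithinAt.const_add u
    have h3 := h1.comp_hasDerivWithinAt t h2 hmem
    have h4 := (ContinuousMultilinearMap.apply ℝ (fun _ : Fin k => Fin n → ℝ) ℝ
      (fun _ => w)).hasFDerivAt.comp_hasDerivWithinAt t h3
    exact h4
  · intro t ht
    simp only [hh, zero_smul, add_zero, iteratedFDerivWithin_diag]
    rw [← Finset.sum_sub_distrib]
    -- `√n ≤ n` compares the Euclidean norm with the sup norm at the cost of a constant
    have hnorm : ‖WithLp.toLp 2 (u + t • w - u)‖ ≤ n * δ := by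
      rw [EuclideanSpace.norm_eq]
      refine (Real.sqrt_le_left (by positivity)).2 ?_
      calc ∑ i, ‖(WithLp.toLp 2 (u + t • w - u)) i‖ ^ 2 ≤ ∑ i : Fin n, δ ^ 2 := by
            refine Finset.sum_le_sum fun i _ => ?_
            refine pow_le_pow_left₀ (norm_nonneg _) ?_ 2
            simp only [add_sub_cancel_left, Pi.smul_apply, smul_eq_mul, norm_mul,
              Real.norm_eq_abs, abs_of_nonneg ht.1]
            exact (mul_le_of_le_one_left (abs_nonneg _) ht.2).trans (hyu i)
        _ = n * δ ^ 2 := by simp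
        _ ≤ (n * δ) ^ 2 := by
            have : (1 : ℝ) ≤ n := by exact_mod_cast hn
            rw [mul_pow]
            gcongr
            nlinarith
    calc |∑ v : Fin m → Fin n, ((∏ i, w (v i)) * cubePartial g m v (u + t • w) -
          (∏ i, w (v i)) * cubePartial g m v u)|
        ≤ ∑ v : Fin m → Fin n, δ ^ m * (r * (n * δ) ^ (α - m)) := by
          refine (Finset.abs_sum_le_sum_abs _ _).trans (Finset.sum_le_sum fun v _ => ?_)
          rw [← mul_sub, abs_mul]
          refine mul_le_mul ?_ ?_ (abs_nonneg _) (by positivity)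
          · rw [Finset.abs_prod]
            refine (Finset.prod_le_prod (fun _ _ => abs_nonneg _) fun i _ => hyu (v i)).trans ?_
            simp
          · refine (abs_cubePartial_sub_le hr hg v (hmem t ht) hu).trans ?_
            gcongr
      _ = r * (n * δ) ^ α := by
          have e : (n * δ) ^ α = (n * δ) ^ m * (n * δ) ^ (α - m) := by
            rw [← Real.rpow_natCast, ← Real.rpow_add (by positivity)]
            congr 1
            ring
          rw [e, mul_pow]
          simp
          ring

/-! ### A partition of unity into hat functions -/

theorem sum_hat_range (M : ℕ) {z : ℝ} (hz : 0 ≤ z) :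
    ∑ u ∈ Finset.range (M + 1), max (1 - |z - u|) 0 = min 1 (max (M + 1 - z) 0) := by
  induction M with
  | zero =>
    simp only [zero_add, Finset.range_one, Finset.sum_singleton, Nat.cast_zero, sub_zero,
      abs_of_nonneg hz]
    rw [min_eq_right]
    exact max_le (by linarith) zero_le_one
  | succ M ih =>
    rw [Finset.sum_range_succ, ih]
    push_cast
    rcases le_total z M with h | h
    · rw [min_eq_left, max_eq_right, min_eq_left]
      · ring
      · exact le_max_of_le_left (by linarith)
      · have := neg_abs_le (z - (M + 1))
        have := abs_of_nonpos (show z - ((M : ℝ) + 1) ≤ 0 by linarith)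
        linarith
      · exact le_max_of_le_left (by linarith)
    · have h0 : min 1 (max ((M : ℝ) + 1 - z) 0) = max ((M : ℝ) + 1 - z) 0 :=
        min_eq_right (max_le (by linarith) zero_le_one)
      rw [h0]
      rcases le_total z (M + 1) with h' | h'
      · rw [abs_of_nonpos (by linarith), max_eq_left (by linarith), max_eq_left (by linarith),
          min_eq_left]
        · ring
        · exact le_max_of_le_left (by linarith)
      · rw [abs_of_nonneg (by linarith), max_eq_right (by linarith : (M : ℝ) + 1 - z ≤ 0),
          min_eq_right, zero_add]
        · congr 1
          ring
        · exact max_le (by linarith) zero_le_one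

theorem sum_prod_hat {n : ℕ} (M : ℕ) {y : Fin n → ℝ} (hy : y ∈ unitCube n) :
    ∑ u : Fin n → Fin (M + 1), ∏ i, max (1 - |M * y i - (u i : ℕ)|) 0 = 1 := by
  rw [← Fintype.prod_sum (fun i (j : Fin (M + 1)) => max (1 - |M * y i - (j : ℕ)|) 0)]
  refine Finset.prod_eq_one fun i _ => ?_
  have h1 : y i ≤ 1 := hy.2 i
  have h0 : 0 ≤ y i := hy.1 i
  have hM : (M : ℝ) * y i ≤ M := mul_le_of_le_one_right (by positivity) h1
  rw [Fin.sum_univ_eq_sum_range (fun j => max (1 - |M * y i - (j : ℝ)|) 0),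
    sum_hat_range M (by positivity), min_eq_left]
  exact le_max_of_le_left (by linarith)

/-! ### Local polynomials as sums of products of hat functions -/

/-- Indices of the monomials in the expansion of a Taylor polynomial of order `m`: a degree, a
tuple of coordinates, and the set of positions at which the coordinate is chosen from the factor
`y i - u i`. -/
abbrev MonomialIndex (n m : ℕ) : Type :=
  Σ k : Fin (m + 1), (Fin k → Fin n) × Finset (Fin k)

/-- The `m` functionals `s` for which the monomial with index `τ` is the product of the
`max (1 - |s y|) 0` on the unit cube: `1 - y i` for the factor `y i`, and `0` for the factor `1`. -/
noncomputable def monomialFactor {n m : ℕ} (hn : 0 < n) (τ : MonomialIndex n m) (l : Fin m)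
    (y : Fin n → ℝ) : ℝ :=
  if l ∈ τ.2.2.map (Fin.castLEEmb (Nat.lt_succ_iff.1 τ.1.2)) then
    1 - y (Function.extend (Fin.castLEEmb (Nat.lt_succ_iff.1 τ.1.2)) τ.2.1 (fun _ => ⟨0, hn⟩) l)
  else 0

theorem prod_monomialFactor {n m : ℕ} (hn : 0 < n) (τ : MonomialIndex n m) {y : Fin n → ℝ}
    (hy : y ∈ unitCube n) :
    ∏ l, max (1 - |monomialFactor hn τ l y|) 0 = ∏ i ∈ τ.2.2, y (τ.2.1 i) := by
  set e := Fin.castLEEmb (Nat.lt_succ_iff.1 τ.1.2) with he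
  have h1 : ∀ l, max (1 - |monomialFactor hn τ l y|) 0 = if l ∈ τ.2.2.map e then
      y (Function.extend e τ.2.1 (fun _ => ⟨0, hn⟩) l) else 1 := by
    intro l
    have h0 : ∀ i, 0 ≤ y i := fun i => hy.1 i
    have h1 : ∀ i, y i ≤ 1 := fun i => hy.2 i
    unfold monomialFactor
    split_ifs
    · rw [abs_of_nonneg (sub_nonneg.2 (h1 _)), sub_sub_cancel, max_eq_left (h0 _)]
    · simp
  rw [Finset.prod_congr rfl fun l _ => h1 l, Finset.prod_ite_mem, Finset.univ_inter,
    Finset.prod_map]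
  refine Finset.prod_congr rfl fun i _ => ?_
  rw [e.injective.extend_apply]

/-- The functionals whose hat functions multiply to a monomial times a grid bump function. -/
noncomputable def localFactor {n m : ℕ} (hn : 0 < n) (M : ℕ) (u : Fin n → Fin (M + 1))
    (τ : MonomialIndex n m) : Fin n ⊕ Fin m → (Fin n → ℝ) → ℝ
  | .inl i, y => M * y i - (u i : ℕ)
  | .inr l, y => monomialFactor hn τ l y

/-- The grid point with index `u`. -/
noncomputable def gridPoint {n : ℕ} (M : ℕ) (u : Fin n → Fin (M + 1)) : Fin n → ℝ :=
  fun i => (u i : ℕ) / M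

theorem gridPoint_mem {n M : ℕ} (hM : 0 < M) (u : Fin n → Fin (M + 1)) :
    gridPoint M u ∈ unitCube n := by
  have hM' : (0 : ℝ) < M := by exact_mod_cast hM
  refine ⟨fun i => ?_, fun i => ?_⟩
  · exact div_nonneg (by positivity) hM'.le
  · refine (div_le_one hM').2 ?_
    exact_mod_cast Nat.lt_succ_iff.1 (u i).2

theorem exists_cubeTaylor_coeff {n m : ℕ} (hn : 0 < n) {r : ℝ} {g : (Fin n → ℝ) → ℝ}
    {u : Fin n → ℝ} (hu : u ∈ unitCube n) (hr : 0 ≤ r)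
    (hg : ∀ k ≤ m, ∀ v : Fin k → Fin n, |cubePartial g k v u| ≤ r) :
    ∃ c : MonomialIndex n m → ℝ, (∀ τ, |c τ| ≤ r) ∧ ∀ y ∈ unitCube n,
      cubeTaylor g m u y = ∑ τ, c τ * ∏ l, max (1 - |monomialFactor hn τ l y|) 0 := by
  refine ⟨fun τ => 1 / ((τ.1 : ℕ).factorial : ℝ) * cubePartial g τ.1 τ.2.1 u *
    ∏ i ∈ τ.2.2ᶜ, -u (τ.2.1 i), fun τ => ?_, fun y hy => ?_⟩
  · rw [abs_mul, abs_mul, Finset.abs_prod]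
    have h1 : |1 / ((τ.1 : ℕ).factorial : ℝ)| ≤ 1 := by
      rw [abs_of_nonneg (by positivity), div_le_one (by positivity)]
      exact_mod_cast Nat.factorial_pos _
    have h2 := hg τ.1 (Nat.lt_succ_iff.1 τ.1.2) τ.2.1
    have h3 : ∏ i ∈ τ.2.2ᶜ, |(-u (τ.2.1 i))| ≤ 1 := by
      refine Finset.prod_le_one (fun _ _ => abs_nonneg _) fun i _ => ?_
      rw [abs_neg, abs_of_nonneg (hu.1 _)]
      exact hu.2 _
    calc _ ≤ 1 * r * 1 := by gcongr
      _ = r := by ring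
  · rw [Finset.sum_congr rfl fun τ _ => by rw [prod_monomialFactor hn τ hy]]
    rw [Fintype.sum_sigma, cubeTaylor]
    refine Finset.sum_congr rfl fun k _ => ?_
    rw [Fintype.sum_prod_type]
    refine Finset.sum_congr rfl fun v _ => ?_
    simp only [sub_eq_add_neg]
    rw [Fintype.prod_add, Finset.mul_sum]
    refine Finset.sum_congr rfl fun s _ => ?_
    ring

/-- Hölder functions are approximated by grid bumps times polynomials. -/
theorem exists_local_approx {n : ℕ} (hn : 0 < n) {α r : ℝ} (hα : 0 < α) (hr : 0 ≤ r)
    {g : (Fin n → ℝ) → ℝ} (hg : g ∈ holderBall n α r) {M : ℕ} (hM : 0 < M) :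
    ∃ c : (Fin n → Fin (M + 1)) × MonomialIndex n (holderOrder α) → ℝ, (∀ j, |c j| ≤ r) ∧
      ∀ y ∈ unitCube n, |g y - ∑ j, c j * ∏ l, max (1 - |localFactor hn M j.1 j.2 l y|) 0| ≤
        r * (n / M) ^ α := by
  have hM' : (0 : ℝ) < M := by exact_mod_cast hM
  choose c hc hcT using fun u : Fin n → Fin (M + 1) =>
    exists_cubeTaylor_coeff hn (gridPoint_mem hM u) hr
      fun k hk v => abs_cubePartial_le hr hg hk v (gridPoint_mem hM u)
  refine ⟨fun j => c j.1 j.2, fun j => hc _ _, fun y hy => ?_⟩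
  set φ : (Fin n → Fin (M + 1)) → ℝ := fun u => ∏ i, max (1 - |M * y i - (u i : ℕ)|) 0 with hφ
  have hφ0 : ∀ u, 0 ≤ φ u := fun u => Finset.prod_nonneg fun i _ => le_max_right _ _
  have hsum : ∑ u, φ u = 1 := sum_prod_hat M hy
  have e1 : ∑ j : (Fin n → Fin (M + 1)) × MonomialIndex n (holderOrder α), c j.1 j.2 *
      ∏ l, max (1 - |localFactor hn M j.1 j.2 l y|) 0 =
      ∑ u, φ u * cubeTaylor g (holderOrder α) (gridPoint M u) y := by
    rw [Fintype.sum_prod_type]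
    refine Finset.sum_congr rfl fun u _ => ?_
    rw [hcT u y hy, Finset.mul_sum]
    refine Finset.sum_congr rfl fun τ _ => ?_
    rw [Fintype.prod_sum_type]
    simp only [localFactor, hφ]
    ring
  have e2 : g y = ∑ u, φ u * g y := by rw [← Finset.sum_mul, hsum, one_mul]
  rw [e1]
  nth_rw 1 [e2]
  rw [← Finset.sum_sub_distrib]
  calc _ ≤ ∑ u, φ u * (r * (n / M) ^ α) := by
        refine (Finset.abs_sum_le_sum_abs _ _).trans (Finset.sum_le_sum fun u _ => ?_)
        rw [← mul_sub, abs_mul, abs_of_nonneg (hφ0 u)]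
        by_cases h0 : φ u = 0
        · simp [h0]
        refine mul_le_mul_of_nonneg_left ?_ (hφ0 u)
        rw [div_eq_mul_one_div]
        refine abs_sub_cubeTaylor_le hα hr hg (gridPoint_mem hM u) hy (by positivity) hn
          fun i => ?_
        -- only the bumps of the neighbouring grid points do not vanish at `y`
        have hi : max (1 - |M * y i - (u i : ℕ)|) 0 ≠ 0 := Finset.prod_ne_zero_iff.1 h0 i
          (Finset.mem_univ i)
        have hi' : |M * y i - (u i : ℕ)| ≤ 1 := by
          by_contra hcon
          exact hi (max_eq_right (by linarith))
        have e3 : y i - gridPoint M u i = (M * y i - (u i : ℕ)) / M := by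
          unfold gridPoint
          field_simp
        rw [e3, abs_div, abs_of_pos hM']
        gcongr
    _ = r * (n / M) ^ α := by rw [← Finset.sum_mul, hsum, one_mul]

/-! ### The network of a family of smooth pieces -/

theorem AffineBounded.sum {m ι : Type} [Fintype m] {B : ℝ≥0} {F : ι → (m → ℝ) → ℝ}
    (s : Finset ι) (hF : ∀ i, AffineBounded B (F i)) :
    AffineBounded (s.card * B) fun x => ∑ i ∈ s, F i x := by
  classical
  induction s using Finset.induction_on with
  | empty => simpa using AffineBounded.const (m := m) 0
  | insert i s hi ih =>
    simp only [Finset.sum_insert hi, Finset.card_insert_of_notMem hi]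
    refine ((hF i).add ih).mono (le_of_eq ?_)
    push_cast
    ring

theorem AffineBounded.sum_injective {m ι : Type} [Fintype m] [Fintype ι] {B : ℝ≥0} {e : ι → m}
    (he : e.Injective) {c : ι → ℝ} (hc : ∀ i, ‖c i‖₊ ≤ B) :
    AffineBounded B fun x => ∑ i, c i * x (e i) := by
  refine ⟨Function.extend e c 0, 0, fun k => ?_, by simp, fun x => ?_⟩
  · by_cases h : ∃ i, e i = k
    · obtain ⟨i, rfl⟩ := h
      rw [he.extend_apply]
      exact hc i
    · rw [Function.extend_apply' _ _ _ h]
      simp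
  · rw [add_zero]
    refine Fintype.sum_of_injective e he _ _ (fun k hk => ?_) fun i => ?_
    · rw [Function.extend_apply' _ _ _ (by simpa using hk)]
      simp
    · rw [he.extend_apply]

theorem affineBounded_localFactor {n m : ℕ} (hn : 0 < n) {M : ℕ} {B : ℝ≥0} (hB : 16 ≤ B)
    (hM : 2 * (M : ℝ≥0) ≤ B) (u : Fin n → Fin (M + 1)) (τ : MonomialIndex n m)
    (l : Fin n ⊕ Fin m) (j : Fin (n + 1)) :
    AffineBounded B fun x : Fin (n + 1) → ℝ => localFactor hn M u τ l (j.removeNth x) := by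
  have hc : ∀ i, AffineBounded 1 fun x : Fin (n + 1) → ℝ => j.removeNth x i :=
    fun i => .coord (j.succAbove i)
  rcases l with i | l
  · refine (((hc i).smul (M : ℝ)).sub (.const ((u i : ℕ) : ℝ))).mono (le_trans ?_ hM)
    have h1 : ((u i : ℕ) : ℝ≥0) ≤ M := by exact_mod_cast Nat.lt_succ_iff.1 (u i).2
    simp only [Real.nnnorm_natCast, mul_one]
    rw [two_mul]
    gcongr
  · have h2 : (2 : ℝ≥0) ≤ B := le_trans (by rw [← NNReal.coe_le_coe]; norm_num) hB
    simp only [localFactor, monomialFactor]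
    split_ifs
    · exact ((AffineBounded.const 1).sub (hc _)).mono
        (le_trans (by rw [← NNReal.coe_le_coe]; norm_num) h2)
    · exact (AffineBounded.const 0).mono (by simp)

/-- The ramp that rises from `0` at `1 / 2` to `1` at `3 / 2`. -/
noncomputable def ramp (z : ℝ) : ℝ := max (z - 1 / 2) 0 - max (z - 3 / 2) 0

theorem ramp_le_one (z : ℝ) : ramp z ≤ 1 := by
  unfold ramp
  rcases max_cases (z - 1 / 2) 0 with ⟨h, _⟩ | ⟨h, _⟩ <;>
    rcases max_cases (z - 3 / 2) 0 with ⟨h', _⟩ | ⟨h', _⟩ <;> rw [h, h'] <;> linarith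

theorem ramp_eq_zero {z : ℝ} (hz : z ≤ 1 / 2) : ramp z = 0 := by
  unfold ramp
  rw [max_eq_right (by linarith), max_eq_right (by linarith), sub_self]

theorem ramp_eq_one {z : ℝ} (hz : 3 / 2 ≤ z) : ramp z = 1 := by
  unfold ramp
  rw [max_eq_left (by linarith), max_eq_left (by linarith)]
  ring

namespace SmoothPieces

variable {n : ℕ} {α r : ℝ} {K T : ℕ}

theorem sum_indicator_le_one (P : SmoothPieces n α r K T) (x : Fin (n + 1) → ℝ) :
    ∑ t, (P.A t).indicator (fun _ => (1 : ℝ)) x ≤ 1 := by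
  by_cases h : ∃ t, x ∈ P.A t
  · obtain ⟨t, ht⟩ := h
    rw [Finset.sum_eq_single t]
    · exact Set.indicator_le' (fun _ _ => le_rfl) (fun _ _ => zero_le_one) x
    · intro s _ hs
      exact Set.indicator_of_notMem (fun hx => Set.disjoint_left.1 (P.disjoint hs) hx ht) _
    · simp
  · push Not at h
    rw [Finset.sum_eq_zero fun t _ => Set.indicator_of_notMem (h t) _]
    exact zero_le_one

/-- The functionals whose hat functions multiply to the terms of an approximation of
`x j - g (x without j)`: the coordinate `x j` itself, and the terms that approximate `g`. -/
noncomputable def termFactor (P : SmoothPieces n α r K T) (hn : 0 < n) (M m : ℕ)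
    (i : (Fin T × Fin K) × Option ((Fin n → Fin (M + 1)) × MonomialIndex n m))
    (l : Fin n ⊕ Fin m) (x : Fin (n + 1) → ℝ) : ℝ :=
  match i.2 with
  | none => if l = .inl ⟨0, hn⟩ then 1 - x (P.j i.1.1 i.1.2) else 0
  | some v => localFactor hn M v.1 v.2 l ((P.j i.1.1 i.1.2).removeNth x)

theorem affineBounded_termFactor (P : SmoothPieces n α r K T) (hn : 0 < n) {M m : ℕ} {B : ℝ≥0}
    (hB : 16 ≤ B) (hM : 2 * (M : ℝ≥0) ≤ B)
    (i : (Fin T × Fin K) × Option ((Fin n → Fin (M + 1)) × MonomialIndex n m))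
    (l : Fin n ⊕ Fin m) : AffineBounded B (P.termFactor hn M m i l) := by
  rcases i with ⟨i, (_ | v)⟩
  · have h2 : (2 : ℝ≥0) ≤ B := le_trans (by rw [← NNReal.coe_le_coe]; norm_num) hB
    unfold termFactor
    dsimp only
    split_ifs
    · exact ((AffineBounded.const 1).sub (.coord _)).mono
        (le_trans (by rw [← NNReal.coe_le_coe]; norm_num) h2)
    · exact (AffineBounded.const 0).mono (by simp)
  · exact affineBounded_localFactor hn hB hM v.1 v.2 l _

/-- The functions `x j - g (x without j)` are approximated by finite sums of products of hat
functions. -/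
theorem exists_termCoeff (P : SmoothPieces n α r K T) (hn : 0 < n) (hα : 0 < α) (hr : 0 ≤ r)
    {M : ℕ} (hM : 0 < M) (i : Fin T × Fin K) :
    ∃ c : Option ((Fin n → Fin (M + 1)) × MonomialIndex n (holderOrder α)) → ℝ,
      (∀ o, |c o| ≤ max 1 r) ∧ ∀ x ∈ unitCube (n + 1),
        |(x (P.j i.1 i.2) - P.g i.1 i.2 ((P.j i.1 i.2).removeNth x)) -
          ∑ o, c o * ∏ l, max (1 - |P.termFactor hn M (holderOrder α) (i, o) l x|) 0| ≤
        r * (n / M) ^ α := by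
  obtain ⟨c, hc, hca⟩ := exists_local_approx hn hα hr (P.g_mem i.1 i.2) hM
  refine ⟨fun o => o.elim 1 fun v => -c v, ?_, fun x hx => ?_⟩
  · rintro (_ | v)
    · simp
    · simpa using Or.inr (hc v)
  · have hy : (P.j i.1 i.2).removeNth x ∈ unitCube n :=
      ⟨fun l => hx.1 _, fun l => hx.2 _⟩
    have hx0 : 0 ≤ x (P.j i.1 i.2) := hx.1 _
    have hx1 : x (P.j i.1 i.2) ≤ 1 := hx.2 _
    have hnone : ∏ l, max (1 - |P.termFactor hn M (holderOrder α) (i, none) l x|) 0 =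
        x (P.j i.1 i.2) := by
      rw [Finset.prod_eq_single (.inl ⟨0, hn⟩)]
      · simp only [termFactor, if_true]
        rw [abs_of_nonneg (sub_nonneg.2 hx1), sub_sub_cancel, max_eq_left hx0]
      · intro l _ hl
        simp [termFactor, hl]
      · simp
    rw [Fintype.sum_option, hnone]
    simp only [Option.elim_none, Option.elim_some, one_mul, neg_mul, Finset.sum_neg_distrib]
    rw [← abs_neg]
    refine le_of_eq_of_le ?_ (hca _ hy)
    congr 1
    simp only [termFactor]
    ring

/-- The network for a given grid size `M` and a given number `k` of squaring steps, provided that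
the resulting error is at most a quarter of the margin. -/
theorem exists_mem_dnnClass (P : SmoothPieces n α r K T) (hn : 0 < n) (hα : 0 < α) (hr : 0 ≤ r)
    (hK : 1 ≤ K) {ξ : ℝ} (hξ : 0 < ξ) {M k q I : ℕ} (hM : 0 < M)
    (hq : q = n + holderOrder α) (hI : I = T * K *
      ((M + 1) ^ n * Fintype.card (MonomialIndex n (holderOrder α)) + 1))
    (herr : r * (n / M) ^ α + ((M + 1) ^ n * Fintype.card (MonomialIndex n (holderOrder α)) + 1) *
      (max 1 r * (q * (1 / 4) ^ k)) ≤ ξ / 4)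
    {B : ℝ} (hB : 16 ≤ B) (hBM : 2 * M ≤ B) (hBξ : 2 / ξ * max 1 r + 2 ≤ B) (hBK : 3 * K ≤ B)
    (hBT : 2 * T + 1 ≤ B) {L N S : ℝ} (hL : ((q * (k + 3) + 4 : ℕ) : ℝ) ≤ L)
    (hN : ((I * (2 * q + 7) + 2 * (T * K) + T : ℕ) : ℝ) ≤ N)
    (hS : ((I * ((2 * q + 8) ^ 2 * (n + 3 + q * (k + 3))) + 2 * (T * K) * (I * (q + 1) + 1) +
      T * (2 * (T * K) + 1) + T + 1 : ℕ) : ℝ) ≤ S) :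
    ∃ f ∈ dnnClass (n + 1) L N S B 1, ∀ x ∈ P.B ξ, f x = P.classifier x := by
  lift B to ℝ≥0 using by linarith
  have hB' : 16 ≤ B := by exact_mod_cast hB
  have hBM' : 2 * (M : ℝ≥0) ≤ B := by exact_mod_cast hBM
  set m := holderOrder α with hm
  set N' := I * (2 * q + 7) + 2 * (T * K) + T with hN'
  let U := (Fin n → Fin (M + 1)) × MonomialIndex n m
  have hcU : Fintype.card (Option U) = (M + 1) ^ n * Fintype.card (MonomialIndex n m) + 1 := by
    simp only [U, Fintype.card_option, Fintype.card_prod, Fintype.card_fun, Fintype.card_fin]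
  have hcI : Fintype.card ((Fin T × Fin K) × Option U) = I := by
    rw [Fintype.card_prod, hcU, Fintype.card_prod, Fintype.card_fin, Fintype.card_fin, hI]
  have hcq : Fintype.card (Fin n ⊕ Fin m) = q := by simp [hq]
  obtain ⟨Q, hQ, hQe⟩ := exists_hiddenLayers_prod_hat hB' (P.termFactor hn M m)
    (P.affineBounded_termFactor hn hB' hBM') k
  rw [hcI, hcq, Fintype.card_fin] at hQ
  simp only [hcq] at hQe
  choose c hc hca using P.exists_termCoeff hn hα hr hM
  -- the approximations of the functions `x j - g (x without j)`
  set H : Fin T × Fin K → ((((Fin T × Fin K) × Option U) × ((Fin n ⊕ Fin m) ⊕ Unit)) → ℝ) → ℝ :=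
    fun i y => ∑ o, c i o * y ((i, o), .inr ()) with hH
  have hHerr : ∀ x ∈ unitCube (n + 1), ∀ i : Fin T × Fin K,
      |(x (P.j i.1 i.2) - P.g i.1 i.2 ((P.j i.1 i.2).removeNth x)) - H i (Q x)| ≤ ξ / 4 := by
    intro x hx i
    have h1 : |∑ o, c i o * ∏ l, max (1 - |P.termFactor hn M m (i, o) l x|) 0 - H i (Q x)| ≤
        ((M + 1) ^ n * Fintype.card (MonomialIndex n m) + 1) *
          (max 1 r * (q * (1 / 4) ^ k)) := by
      rw [hH, ← Finset.sum_sub_distrib]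
      refine (Finset.abs_sum_le_sum_abs _ _).trans ?_
      refine (Finset.sum_le_card_nsmul _ _ (max 1 r * (q * (1 / 4) ^ k)) fun o _ => ?_).trans ?_
      · rw [← mul_sub, abs_mul, abs_sub_comm]
        exact mul_le_mul (hc i o) (hQe x (i, o)) (abs_nonneg _) (by positivity)
      · rw [Finset.card_univ, hcU, nsmul_eq_mul]
        push_cast
        exact le_rfl
    exact (abs_sub_le _ _ _).trans ((add_le_add (hca i x hx) h1).trans herr)
  obtain ⟨R, hR⟩ : ∃ R : ℝ≥0, (R : ℝ) = max 1 r := ⟨⟨max 1 r, by positivity⟩, rfl⟩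
  have hHaff : ∀ i, AffineBounded R (H i) := by
    intro i
    refine AffineBounded.sum_injective (e := fun o => ((i, o), Sum.inr ())) ?_ fun o => ?_
    · intro o o' h
      simpa using h
    · rw [← NNReal.coe_le_coe, hR]
      exact hc i o
  -- the layer that computes the two positive parts in each ramp
  have h1 := HiddenLayers.dense (N := N') (B := B)
    (F := fun y (j : (Fin T × Fin K) × Bool) =>
      2 / ξ * H j.1 y - (if j.2 then 1 / 2 else 3 / 2)) (by
    rintro ⟨i, b⟩
    refine (((hHaff i).smul (2 / ξ)).sub (.const _)).mono ?_
    rw [← NNReal.coe_le_coe]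
    refine le_trans ?_ hBξ
    have e1 : |2 / ξ| = 2 / ξ := abs_of_pos (by positivity)
    simp only [NNReal.coe_add, NNReal.coe_mul, coe_nnnorm, Real.norm_eq_abs, e1, hR]
    gcongr
    split_ifs <;> norm_num [abs_of_pos]) (by
    simp only [Fintype.card_prod, Fintype.card_fin, Fintype.card_bool]
    rw [hN', mul_comm]
    omega)
  -- the layer that intersects the basis pieces
  have h2 := HiddenLayers.dense (N := N') (B := B)
    (F := fun (y : (Fin T × Fin K) × Bool → ℝ) (t : Fin T) =>
      ∑ k, (y ((t, k), true) - y ((t, k), false)) - ((K : ℝ) - 1)) (by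
    intro t
    refine ((AffineBounded.sum Finset.univ fun k =>
      (AffineBounded.coord ((t, k), true)).sub (.coord ((t, k), false))).sub (.const _)).mono ?_
    rw [← NNReal.coe_le_coe]
    refine le_trans ?_ hBK
    have hK' : (1 : ℝ) ≤ K := by exact_mod_cast hK
    have e1 : |(K : ℝ) - 1| = K - 1 := abs_of_nonneg (by linarith)
    simp only [NNReal.coe_add, NNReal.coe_mul, coe_nnnorm, Real.norm_eq_abs, e1,
      NNReal.coe_one, Finset.card_univ, Fintype.card_fin, NNReal.coe_natCast]
    linarith) (by
    simp only [Fintype.card_fin]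
    omega)
  have hout : AffineBounded B fun y : Fin T → ℝ => 2 * ∑ t, y t - 1 := by
    refine (((AffineBounded.sum Finset.univ fun t => AffineBounded.coord t).smul 2).sub
      (.const 1)).mono ?_
    rw [← NNReal.coe_le_coe]
    refine le_trans ?_ hBT
    simp
  have hnet := h2.comp (h1.comp (hQ.mono (by omega : _ ≤ N') le_rfl))
  simp only [Fintype.card_prod, Fintype.card_sum, Fintype.card_fin, Fintype.card_bool,
    Fintype.card_unit] at hnet
  -- the values of the network on the cube
  set a : (Fin (n + 1) → ℝ) → Fin T → ℝ := fun x t =>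
    max (∑ k, ramp (2 / ξ * H (t, k) (Q x)) - ((K : ℝ) - 1)) 0 with ha
  have ha0 : ∀ x t, 0 ≤ a x t := fun x t => le_max_right _ _
  have ha1 : ∀ x t, a x t ≤ 1 := by
    intro x t
    refine max_le ?_ zero_le_one
    have : ∑ k, ramp (2 / ξ * H (t, k) (Q x)) ≤ ∑ k : Fin K, (1 : ℝ) :=
      Finset.sum_le_sum fun k _ => ramp_le_one _
    simp at this
    linarith
  have ha_out : ∀ x ∈ unitCube (n + 1), ∀ t, x ∉ P.A t → a x t = 0 := by
    intro x hx t hxt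
    obtain ⟨k, hk⟩ : ∃ k, x (P.j t k) < P.g t k ((P.j t k).removeNth x) := by
      by_contra! hcon
      exact hxt (Set.mem_iInter.2 fun k => ⟨hx, hcon k⟩)
    have hle := (abs_le.1 (hHerr x hx (t, k))).1
    dsimp only at hle
    have hr0 : ramp (2 / ξ * H (t, k) (Q x)) = 0 := by
      refine ramp_eq_zero ?_
      rw [div_mul_eq_mul_div, div_le_iff₀ hξ]
      linarith
    have hsum : ∑ k', ramp (2 / ξ * H (t, k') (Q x)) ≤ K - 1 := by
      rw [← Finset.add_sum_erase _ _ (Finset.mem_univ k), hr0, zero_add]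
      refine (Finset.sum_le_card_nsmul _ _ 1 fun _ _ => ramp_le_one _).trans ?_
      rw [Finset.card_erase_of_mem (Finset.mem_univ k), Finset.card_univ, Fintype.card_fin,
        nsmul_eq_mul, mul_one, Nat.cast_sub hK, Nat.cast_one]
    exact max_eq_right (by linarith)
  have ha_in : ∀ x ∈ unitCube (n + 1), ∀ t,
      (∀ k, ξ < x (P.j t k) - P.g t k ((P.j t k).removeNth x)) → a x t = 1 := by
    intro x hx t hxt
    have hr1 : ∀ k, ramp (2 / ξ * H (t, k) (Q x)) = 1 := by
      intro k
      have hle := (abs_le.1 (hHerr x hx (t, k))).2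
      dsimp only at hle
      refine ramp_eq_one ?_
      rw [div_mul_eq_mul_div, le_div_iff₀ hξ]
      linarith [hxt k]
    simp [ha, hr1]
  have ha_ind : ∀ x ∈ unitCube (n + 1), ∀ t, a x t ≤ (P.A t).indicator (fun _ => (1 : ℝ)) x := by
    intro x hx t
    by_cases hxt : x ∈ P.A t
    · rw [Set.indicator_of_mem hxt]
      exact ha1 x t
    · rw [Set.indicator_of_notMem hxt, ha_out x hx t hxt]
  have hnet' : HiddenLayers N' B (2 + q * (k + 3) + 1 + 1)
      (I * ((2 * q + 8) ^ 2 * (n + 3 + q * (k + 3))) + 2 * (T * K) * (I * (q + 1) + 1) +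
        T * (2 * (T * K) + 1)) a := by
    have h := hnet.of_le rfl (S' := I * ((2 * q + 8) ^ 2 * (n + 3 + q * (k + 3))) +
      2 * (T * K) * (I * (q + 1) + 1) + T * (2 * (T * K) + 1)) (by
        rw [hcU, ← hI, ← hq]
        exact le_of_eq (by ring))
    convert h using 2 with x
    funext t
    simp [ha, ramp]
  refine ⟨_, hnet'.mem_dnnClass hout (F := 1) (fun x hx => ?_) (le_trans ?_ hL) hN
    (le_trans ?_ hS) le_rfl, fun x hx => ?_⟩
  · have s0 : 0 ≤ ∑ t, a x t := Finset.sum_nonneg fun t _ => ha0 x t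
    have s1 : ∑ t, a x t ≤ 1 :=
      (Finset.sum_le_sum fun t _ => ha_ind x hx t).trans (P.sum_indicator_le_one x)
    rw [abs_le]
    constructor <;> linarith
  · exact_mod_cast (by omega : 2 + q * (k + 3) + 1 + 1 ≤ q * (k + 3) + 4)
  · rw [Fintype.card_fin]
  · simp only [classifier]
    congr 2
    refine Finset.sum_congr rfl fun t _ => ?_
    rcases hx.2 t with hxt | ⟨hxt, hxm⟩
    · rw [ha_out x hx.1 t hxt, Set.indicator_of_notMem hxt]
    · rw [ha_in x hx.1 t hxm, Set.indicator_of_mem hxt]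

end SmoothPieces

/-! ### Choice of the grid size and of the number of squaring steps -/

/-- A grid of order `ξ ^ (-(1 / α))` points per direction makes the Taylor error at most `ξ / 8`. -/
theorem exists_grid_size {n : ℕ} (hn : 0 < n) {α r : ℝ} (hα : 0 < α) (hr : 0 < r) :
    ∃ D : ℝ, 0 < D ∧ ∀ ξ : ℝ, 0 < ξ → ξ ≤ 1 → ∃ M : ℕ, 0 < M ∧
      (M : ℝ) + 1 ≤ D * ξ ^ (-(1 / α)) ∧ r * (n / M) ^ α ≤ ξ / 8 := by
  have hn' : (0 : ℝ) < n := by exact_mod_cast hn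
  set a : ℝ := (1 / (8 * r)) ^ (1 / α) with ha
  have ha0 : 0 < a := by positivity
  refine ⟨n / a + 2, by positivity, fun ξ hξ hξ1 => ?_⟩
  have hY1 : 1 ≤ ξ ^ (-(1 / α)) :=
    Real.one_le_rpow_of_pos_of_le_one_of_nonpos hξ hξ1 (by simp [hα.le])
  have hYpos : 0 < ξ ^ (-(1 / α)) := by positivity
  have hpos : 0 < n / a * ξ ^ (-(1 / α)) := by positivity
  have hM := Nat.le_ceil (n / a * ξ ^ (-(1 / α)))
  have hM2 := Nat.ceil_lt_add_one hpos.le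
  have hM0 : 0 < ⌈n / a * ξ ^ (-(1 / α))⌉₊ := Nat.ceil_pos.2 hpos
  refine ⟨⌈n / a * ξ ^ (-(1 / α))⌉₊, hM0, by linarith, ?_⟩
  have hM0' : (0 : ℝ) < ⌈n / a * ξ ^ (-(1 / α))⌉₊ := by exact_mod_cast hM0
  have h1 : (n : ℝ) / ⌈n / a * ξ ^ (-(1 / α))⌉₊ ≤ a * ξ ^ (1 / α) := by
    rw [div_le_iff₀ hM0']
    calc (n : ℝ) = a * ξ ^ (1 / α) * (n / a * ξ ^ (-(1 / α))) := by
          rw [Real.rpow_neg hξ.le]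
          field_simp
      _ ≤ _ := by gcongr
  calc r * ((n : ℝ) / ⌈n / a * ξ ^ (-(1 / α))⌉₊) ^ α ≤ r * (a * ξ ^ (1 / α)) ^ α := by gcongr
    _ = ξ / 8 := by
      rw [ha, Real.mul_rpow (by positivity) (by positivity), ← Real.rpow_mul (by positivity),
        ← Real.rpow_mul hξ.le, one_div_mul_cancel hα.ne', Real.rpow_one, Real.rpow_one]
      field_simp

/-- Logarithmically many squaring steps beat any power of `ξ`. -/
theorem exists_squaring_steps {c : ℝ} (hc : 0 ≤ c) {ξ : ℝ} (hξ : 0 < ξ) (hξ1 : ξ ≤ 1 / 2) :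
    ∃ k : ℕ, (1 / 4 : ℝ) ^ k ≤ ξ ^ c ∧ (k : ℝ) ≤ (c + 2) * Real.log (1 / ξ) := by
  have hlog : 1 / 2 ≤ Real.log (1 / ξ) := by
    have h2 : (2 : ℝ) ≤ 1 / ξ := by
      rw [le_div_iff₀ hξ]
      linarith
    have := Real.log_le_log (by norm_num) h2
    have := Real.log_two_gt_d9
    linarith
  have hk := Nat.le_ceil (c * Real.log (1 / ξ))
  have hk2 := Nat.ceil_lt_add_one (show 0 ≤ c * Real.log (1 / ξ) by positivity)
  refine ⟨⌈c * Real.log (1 / ξ)⌉₊, ?_, by nlinarith⟩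
  have h4 : (1 / 4 : ℝ) ≤ Real.exp (-1) := by
    rw [Real.exp_neg, one_div]
    exact inv_anti₀ (Real.exp_pos 1) (by linarith [Real.exp_one_lt_d9])
  calc (1 / 4 : ℝ) ^ ⌈c * Real.log (1 / ξ)⌉₊ ≤ Real.exp (-1) ^ ⌈c * Real.log (1 / ξ)⌉₊ := by gcongr
    _ = Real.exp (-(⌈c * Real.log (1 / ξ)⌉₊ : ℝ)) := by
      rw [← Real.exp_nat_mul]
      ring_nf
    _ ≤ Real.exp (-(c * Real.log (1 / ξ))) := Real.exp_le_exp.2 (by linarith)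
    _ = ξ ^ c := by
      rw [Real.rpow_def_of_pos hξ, one_div, Real.log_inv]
      ring_nf

/-- The number of parameters, as a function of the number `I` of terms and the number `k` of
squaring steps, is of the order of the product of their bounds `X` and `ℓ`. -/
theorem parameter_count_le {T K q n I k A E X ℓ : ℝ} (hT : 0 ≤ T) (hK : 0 ≤ K) (hq : 0 ≤ q)
    (hn : 0 ≤ n) (hI0 : 0 ≤ I) (hk : 0 ≤ k) (hX : 1 ≤ X) (hℓ : 1 ≤ 2 * ℓ) (hI : I ≤ A * X)
    (hkE : k + 3 ≤ E * ℓ) :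
    I * ((2 * q + 8) ^ 2 * (n + 3 + q * (k + 3))) + 2 * (T * K) * (I * (q + 1) + 1) +
        T * (2 * (T * K) + 1) + T + 1 ≤
      (A * ((2 * q + 8) ^ 2 * (2 * (n + 3) + q * E)) +
        2 * (2 * (T * K) * (A * (q + 1) + 1) + T * (2 * (T * K) + 1) + T + 1)) * X * ℓ := by
  have h0 : n + 3 + q * (k + 3) ≤ (2 * (n + 3) + q * E) * ℓ := by
    have h1 : q * (k + 3) ≤ q * (E * ℓ) := mul_le_mul_of_nonneg_left hkE hq
    have h2 : (n + 3) * 1 ≤ (n + 3) * (2 * ℓ) := mul_le_mul_of_nonneg_left hℓ (by positivity)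
    linarith
  have h1 : I * ((2 * q + 8) ^ 2 * (n + 3 + q * (k + 3))) ≤
      A * X * ((2 * q + 8) ^ 2 * ((2 * (n + 3) + q * E) * ℓ)) :=
    mul_le_mul hI (mul_le_mul_of_nonneg_left h0 (by positivity)) (by positivity)
      (hI0.trans hI)
  have hA : 0 ≤ A := nonneg_of_mul_nonneg_left (hI0.trans hI) (by linarith)
  have hXℓ : X ≤ 2 * (X * ℓ) := by nlinarith
  have e1 : 2 * (T * K) * (q + 1) * I ≤ 2 * (T * K) * (q + 1) * (A * X) :=
    mul_le_mul_of_nonneg_left hI (by positivity)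
  have e2 : (2 * (T * K) + T * (2 * (T * K) + 1) + T + 1) * 1 ≤
      (2 * (T * K) + T * (2 * (T * K) + 1) + T + 1) * X :=
    mul_le_mul_of_nonneg_left hX (by positivity)
  have e3 := mul_le_mul_of_nonneg_left hXℓ
    (show 0 ≤ 2 * (T * K) * (A * (q + 1) + 1) + T * (2 * (T * K) + 1) + T + 1 by positivity)
  linarith

/-- The dimension is `d = n + 1 ≥ 2`. The constants and the threshold `ξ₀` depend only on
`n, α, r, K, T`. -/
theorem mainTheorem7 (n : ℕ) (hn : 1 ≤ n) (α r : ℝ) (hα : 0 < α) (hr : 0 < r)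
    (K T : ℕ) (hK : 1 ≤ K) (hT : 1 ≤ T) :
    ∃ L₀ N₀ S₀ B₀ b₀ ξ₀ : ℝ,
      0 < L₀ ∧ 0 < N₀ ∧ 0 < S₀ ∧ 0 < B₀ ∧ 0 < b₀ ∧ 0 < ξ₀ ∧
      ∀ (P : SmoothPieces n α r K T) (ξ : ℝ), 0 < ξ → ξ ≤ ξ₀ →
        ∃ f ∈ dnnClass (n + 1) (L₀ * Real.log (1 / ξ)) (N₀ * ξ ^ (-((n : ℝ) / α)))
            (S₀ * ξ ^ (-((n : ℝ) / α)) * Real.log (1 / ξ)) (B₀ * ξ ^ (-b₀)) 1,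
          ∀ x ∈ P.B ξ, f x = P.classifier x := by
  obtain ⟨D, hD, hgrid⟩ := exists_grid_size hn hα hr
  have hT0 : (0 : ℝ) < T := by exact_mod_cast hT
  have hK0 : (0 : ℝ) < K := by exact_mod_cast hK
  obtain ⟨q, hq⟩ : ∃ q, q = n + holderOrder α := ⟨_, rfl⟩
  obtain ⟨τ, hτ⟩ : ∃ τ, τ = Fintype.card (MonomialIndex n (holderOrder α)) := ⟨_, rfl⟩
  -- there are at most `C * ξ ^ (-(n / α))` terms per boundary function; the product error `ξ ^ E`
  -- summed over them leaves a multiple of `ξ ^ 2`, which a small `ξ₀` brings below `ξ / 8`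
  obtain ⟨C, hC⟩ : ∃ C : ℝ, C = D ^ n * τ + 1 := ⟨_, rfl⟩
  obtain ⟨E, hE⟩ : ∃ E : ℝ, E = (n : ℝ) / α + 2 := ⟨_, rfl⟩
  obtain ⟨R, hR⟩ : ∃ R : ℝ, R = max 1 r := ⟨_, rfl⟩
  have hC0 : 0 < C := by rw [hC]; positivity
  have hE0 : 0 < E := by rw [hE]; positivity
  have hR0 : 0 < R := by rw [hR]; positivity
  refine ⟨q * (E + 8) + 8, T * K * C * (2 * q + 7) + 2 * (T * K) + T,
    T * K * C * ((2 * q + 8) ^ 2 * (2 * (n + 3) + q * (E + 8))) +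
      2 * (2 * (T * K) * (T * K * C * (q + 1) + 1) + T * (2 * (T * K) + 1) + T + 1),
    16 + 2 * D + 2 * R + 3 * K + 3 * T, 1 + 1 / α, min (1 / 2) (1 / (8 * (C * R * (q + 1)))),
    by positivity, by positivity, by positivity, by positivity, by positivity, by positivity,
    fun P ξ hξ hξ₀ => ?_⟩
  have hξ2 : ξ ≤ 1 / 2 := hξ₀.trans (min_le_left _ _)
  have hξC : ξ * (8 * (C * R * (q + 1))) ≤ 1 := by
    have := hξ₀.trans (min_le_right _ _)
    rwa [le_div_iff₀ (by positivity)] at this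
  have hξ1 : ξ ≤ 1 := hξ2.trans (by norm_num)
  obtain ⟨M, hM, hMD, hMerr⟩ := hgrid ξ hξ hξ1
  obtain ⟨k, hk, hkE⟩ := exists_squaring_steps hE0.le hξ hξ2
  obtain ⟨ℓ, hℓ⟩ : ∃ ℓ, ℓ = Real.log (1 / ξ) := ⟨_, rfl⟩
  obtain ⟨X, hX⟩ : ∃ X, X = ξ ^ (-((n : ℝ) / α)) := ⟨_, rfl⟩
  obtain ⟨Z, hZ⟩ : ∃ Z, Z = ξ ^ (-(1 + 1 / α)) := ⟨_, rfl⟩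
  rw [← hℓ] at hkE ⊢
  rw [← hX, ← hZ]
  have hℓ1 : 1 ≤ 2 * ℓ := by
    have h2 : (2 : ℝ) ≤ 1 / ξ := by
      rw [le_div_iff₀ hξ]
      linarith
    have := Real.log_le_log (by norm_num) h2
    have := Real.log_two_gt_d9
    linarith
  have hX1 : 1 ≤ X := by
    rw [hX]
    exact Real.one_le_rpow_of_pos_of_le_one_of_nonpos hξ hξ1
      (neg_nonpos.2 (by positivity))
  have hZ1 : 1 ≤ Z := by
    rw [hZ]
    exact Real.one_le_rpow_of_pos_of_le_one_of_nonpos hξ hξ1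
      (neg_nonpos.2 (by positivity))
  have hMZ : (M : ℝ) ≤ D * Z := by
    refine (by linarith : (M : ℝ) ≤ D * ξ ^ (-(1 / α))).trans ?_
    rw [hZ]
    exact mul_le_mul_of_nonneg_left
      (Real.rpow_le_rpow_of_exponent_ge hξ hξ1 (by linarith)) hD.le
  have hξZ : 1 / ξ ≤ Z := by
    rw [hZ, one_div, ← Real.rpow_neg_one]
    have : 0 < 1 / α := by positivity
    exact Real.rpow_le_rpow_of_exponent_ge hξ hξ1 (by linarith)
  have hcount : ((M : ℝ) + 1) ^ n * τ + 1 ≤ C * X := by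
    have h1 : ((M : ℝ) + 1) ^ n ≤ D ^ n * X := by
      calc ((M : ℝ) + 1) ^ n ≤ (D * ξ ^ (-(1 / α))) ^ n := by gcongr
        _ = D ^ n * X := by
          rw [mul_pow, ← Real.rpow_natCast (ξ ^ (-(1 / α))), ← Real.rpow_mul hξ.le, hX]
          congr 2
          ring
    rw [hC, add_mul, one_mul]
    refine add_le_add ?_ hX1
    calc ((M : ℝ) + 1) ^ n * τ ≤ D ^ n * X * τ := by gcongr
      _ = D ^ n * τ * X := by ring
  have hI : ((T * K * ((M + 1) ^ n * τ + 1) : ℕ) : ℝ) ≤ T * K * C * X := by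
    push_cast
    rw [mul_assoc _ C X]
    gcongr
  obtain ⟨I, hI'⟩ : ∃ I, I = T * K * ((M + 1) ^ n * τ + 1) := ⟨_, rfl⟩
  rw [← hI'] at hI
  have hkℓ : (k : ℝ) + 3 ≤ (E + 8) * ℓ := by linarith
  have z1 : 0 < D * Z := by positivity
  have z2 : 0 < R * Z := by positivity
  have z3 : (K : ℝ) ≤ K * Z := le_mul_of_one_le_right hK0.le hZ1
  have z4 : (T : ℝ) ≤ T * Z := le_mul_of_one_le_right hT0.le hZ1
  refine P.exists_mem_dnnClass hn hα hr.le hK hξ hM (k := k) hq (hτ ▸ hI') ?_ ?_ ?_ ?_ ?_ ?_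
    ?_ ?_ ?_
  · rw [← hτ, ← hR]
    have h1 : (((M : ℝ) + 1) ^ n * τ + 1) * (R * (q * (1 / 4) ^ k)) ≤
        C * X * (R * ((q + 1) * ξ ^ E)) := by
      gcongr
      linarith
    have h2 : X * ξ ^ E = ξ ^ 2 := by
      rw [hX, hE, ← Real.rpow_add hξ, ← Real.rpow_natCast]
      congr 1
      push_cast
      ring
    have h3 : C * X * (R * ((q + 1) * ξ ^ E)) = ξ * (8 * (C * R * (q + 1))) * ξ / 8 := by
      linear_combination C * R * (q + 1) * h2
    have h4 : ξ * (8 * (C * R * (q + 1))) * ξ ≤ ξ := mul_le_of_le_one_left hξ.le hξC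
    linarith
  · linarith
  · linarith
  · rw [← hR]
    have h1 : 2 / ξ * R = 2 * R * (1 / ξ) := by ring
    have h2 : 2 * R * (1 / ξ) ≤ 2 * R * Z := by gcongr
    linarith
  · linarith
  · linarith
  · push_cast
    have h1 : (q : ℝ) * (k + 3) ≤ q * ((E + 8) * ℓ) := by gcongr
    linarith
  · push_cast
    have h1 : (I : ℝ) * (2 * q + 7) ≤ T * K * C * X * (2 * q + 7) := by gcongr
    have h2 : (2 * (T * K) + T : ℝ) * 1 ≤ (2 * (T * K) + T) * X := by gcongr
    linarith
  · push_cast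
    exact parameter_count_le (by positivity) (by positivity) (by positivity) (by positivity)
      (by positivity) (by positivity) hX1 hℓ1 hI hkℓ
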